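/- Let $H$ be a separable real Hilbert space and $\mathcal{A}^{-1}\colon H\to H$ a compact, self-adjoint, positive definite operator. Let $\mathcal{A}^{1/2}$ be the inverse of the positive square root of $\mathcal{A}^{-1}$, $V=D(\mathcal{A}^{1/2})$ and $a(u,v)=\langle\mathcal{A}^{1/2}u,\mathcal{A}^{1/2}v\rangle_H$ on $V$. Let $V_0\subset V_1\subset\dots\subset V$ be nested finite-dimensional subspaces with bases $(\phi^\ell_j)_{j=1}^{n_\ell}$, and let $P_\ell x=\sum_j x_j\phi_j^\ell$, $(A_\ell)_{jk}=a(\phi^\ell_j,\phi^\ell_k)$, and let $I_{\ell-1}^\ell\in\mathbb{R}^{n_\ell\times n_{\ell-1}}$ be the matrix of $P_\ell^{-1}P_{\ell-1}$. Assume: 1. There are a decreasing $\Phi\colon\mathbb{N}_0\to[0,\infty)$ and $c_1,c_2>0$ with $c_1\|P_\ell x\|_H\le\Phi(\ell)\|x\|_2\le c_2\|P_\ell x\|_H$ for all $\ell\ge 0$ and $x\in\mathbb{R}^{n_\ell}$. 2. For every $\ell\ge1$ there is a symmetric splitting matrix $M_\ell$ with $0<A_\ell\le M_\ell$ in the Loewner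 order (smoothing property), and there is a constant $C_A>0$ with $\|M_\ell^{1/2}(A_\ell^{-1}-I_{\ell-1}^\ell A_{\ell-1}^{-1}(I_{\ell-1}^\ell)^\top)M_\ell^{1/2}\|_2\le C_A$ for all $\ell\ge1$ (approximation property). 3. $\nu>0$ is an even integer. For $g\in\mathbb{R}^{n_\ell}$ define the Multigrid Monte Carlo (V-cycle) update $\theta\mapsto\mathrm{MGMC}_\ell(g,\theta)$ recursively. For $\ell=0$, $\mathrm{MGMC}_0(g,\theta)$ is a draw from $\mathcal{N}(A_0^{-1}g,A_0^{-1})$. For $\ell\ge1$: apply $\nu/2$ random smoothing steps $\theta\leftarrow\theta+M_\ell^{-1}(g+\xi-A_\ell\theta)$, each with a fresh $\xi\sim\mathcal{N}(0,M_\ell+M_\ell^\top-A_\ell)$; set $\psi=\mathrm{MGMC}_{\ell-1}\bigl((I_{\ell-1}^\ell)^\top(g-A_\ell\theta),0\bigr)$ and $\theta\leftarrow\theta+I_{\ell-1}^\ell\psi$; apply $\nu/2$ further random smoothing steps of the same form. All random draws are independent of each other and of the initial state. Let $f,\chi\in H$, $(f_L)_j=\langle f,\phi^L_j\rangle_H$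 and $(F_L)_j=\langle\chi,\phi_j^L\rangle_H$, and let $C_0,C_1$ be constants. Then there is a constant $C>0$, which may depend on $f$, $\chi$ and the other data above but not on $L$ or $M$, such that for every $L\ge0$, every chain $\theta_L^{(m+1)}=\mathrm{MGMC}_L(f_L,\theta_L^{(m)})$, $m\ge0$, whose initial state $\theta_L^{(0)}$ is square-integrable and satisfies $$\|A_L^{1/2}\operatorname{Cov}(\theta_L^{(0)})A_L^{1/2}\|_2<C_0,\qquad \|\mathbb{E}[A_L^{1/2}\theta_L^{(0)}]\|_2<C_1,$$ and every $M\ge1$, $$\sqrt{\mathbb{E}\Bigl[\Bigl|I(F_L)-\frac1M\sum_{m=1}^M F_L^\top\theta_L^{(m)}\Bigr|^2\Bigr]}\le\frac{C}{\sqrt M},$$ where $I(F_L)=\mathbb{E}[F_L^\top\theta]$ for $\theta\sim\mathcal{N}(A_L^{-1}f_L,A_L^{-1})$; in particular the expectation under the root is finite. -/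

import Mathlib

namespace MGMC

/-! ### The positive square root of a compact positive operator -/

theorem mem_orthogonal_of_hilbertBasis.{u} {H : Type u} [NormedAddCommGroup H] [InnerProductSpace ℝ H]
    (K : Submodule ℝ H) {ι : Type*}
    (e : HilbertBasis ι ℝ K) {x : H} (h : ∀ i, inner ℝ (e i : H) x = 0) : x ∈ Kᗮ := by
  rw [Submodule.mem_orthogonal']
  intro y hy
  have h1 := (e.hasSum_repr ⟨y, hy⟩).mapL ((innerSL ℝ x).comp K.subtypeL)
  have h2 : (fun i => ((innerSL ℝ x).comp K.subtypeL) (e.repr ⟨y, hy⟩ i • e i)) = fun _ => 0 := by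
    funext i
    rw [map_smul]
    have : ((innerSL ℝ x).comp K.subtypeL) (e i) = 0 := by
      change inner ℝ x (e i : H) = 0
      rw [real_inner_comm]; exact h i
    rw [this, smul_zero]
  rw [h2] at h1
  exact h1.unique hasSum_zero

theorem exists_hilbertBasis_of_orthogonalFamily.{u} {H : Type u} [NormedAddCommGroup H] [InnerProductSpace ℝ H]
    [CompleteSpace H]
    (V : ℝ → Submodule ℝ H)
    [∀ μ, CompleteSpace (V μ)]
    (hV : OrthogonalFamily ℝ (fun μ => V μ) fun μ => (V μ).subtypeₗᵢ) (hbot : (⨆ μ, V μ)ᗮ = ⊥) :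
    ∃ (ι : Type u) (b : HilbertBasis ι ℝ H), ∀ i, ∃ μ, b i ∈ V μ := by
  choose w e he using fun μ : ℝ => exists_hilbertBasis ℝ (V μ)
  have hortho := hV.orthonormal_sigma_orthonormal
    (v_family := fun μ => e μ) (fun μ => (e μ).orthonormal)
  have hbot' : (Submodule.span ℝ (Set.range fun a : Σ μ : ℝ, w μ =>
      (V a.1).subtypeₗᵢ (e a.1 a.2)))ᗮ = ⊥ := by
    rw [eq_bot_iff, ← hbot]
    intro x hx
    rw [← Submodule.iInf_orthogonal]
    simp only [Submodule.mem_iInf]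
    intro μ
    exact mem_orthogonal_of_hilbertBasis _ (e μ) fun i =>
      (Submodule.mem_orthogonal _ _).1 hx _ (Submodule.subset_span ⟨⟨μ, i⟩, rfl⟩)
  refine ⟨_, HilbertBasis.mkOfOrthogonalEqBot hortho hbot', ?_⟩
  rintro ⟨μ, i⟩
  rw [HilbertBasis.coe_mkOfOrthogonalEqBot]
  exact ⟨μ, (e μ i).2⟩

theorem exists_eigenbasis.{u} {H : Type u} [NormedAddCommGroup H] [InnerProductSpace ℝ H]
    [CompleteSpace H]
    (T : H →L[ℝ] H) (hc : IsCompactOperator T)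
    (hs : (T : H →ₗ[ℝ] H).IsSymmetric) :
    ∃ (ι : Type u) (b : HilbertBasis ι ℝ H) (d : ι → ℝ), ∀ i, T (b i) = d i • b i := by
  have hcomp : ∀ μ : ℝ, CompleteSpace (Module.End.eigenspace (T : H →ₗ[ℝ] H) μ) := by
    intro μ
    have : IsClosed ((Module.End.eigenspace (T : H →ₗ[ℝ] H) μ : Submodule ℝ H) : Set H) := by
      have h : ((Module.End.eigenspace (T : H →ₗ[ℝ] H) μ : Submodule ℝ H) : Set H)
          = {x | T x = μ • x} := by
        ext x; exact Module.End.mem_eigenspace_iff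
      rw [h]
      exact isClosed_eq T.continuous (continuous_const_smul μ)
    exact this.completeSpace_coe
  obtain ⟨ι, b, h⟩ := exists_hilbertBasis_of_orthogonalFamily _ hs.orthogonalFamily_eigenspaces
    (ContinuousLinearMap.orthogonalComplement_iSup_eigenspaces_eq_bot hc hs)
  choose d hd using h
  exact ⟨ι, b, d, fun i => Module.End.mem_eigenspace_iff.1 (hd i)⟩

theorem exists_diagonal.{u} {H : Type u} [NormedAddCommGroup H] [InnerProductSpace ℝ H]
    {ι : Type*} (b : HilbertBasis ι ℝ H) (m : ι → ℝ) (B : ℝ)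
    (hB : ∀ i, |m i| ≤ B) :
    ∃ S : H →L[ℝ] H, ∀ x i, inner ℝ (b i) (S x) = m i * inner ℝ (b i) x := by
  have hmem : ∀ x : H, Memℓp (fun i => m i * b.repr x i) 2 := by
    intro x
    have h := (lp.memℓp (b.repr x)).const_smul B
    refine memℓp_gen ?_
    have h2 := h.summable (by norm_num)
    refine Summable.of_nonneg_of_le (fun i => by positivity) (fun i => ?_) h2
    refine Real.rpow_le_rpow (norm_nonneg _) ?_ (by norm_num)
    simp only [Pi.smul_apply, norm_smul, norm_mul, Real.norm_eq_abs]
    exact mul_le_mul_of_nonneg_right ((hB i).trans (le_abs_self B)) (abs_nonneg _)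
  let L : H →ₗ[ℝ] H :=
    { toFun := fun x => b.repr.symm ⟨fun i => m i * b.repr x i, hmem x⟩
      map_add' := by
        intro x y
        rw [← map_add]; congr 1; ext i; exact (congrArg (m i * ·) (by simp)).trans (mul_add _ _ _)
      map_smul' := by
        intro c x
        rw [RingHom.id_apply, ← map_smul]; congr 1; ext i
        change m i * b.repr (c • x) i = c * (m i * b.repr x i)
        rw [map_smul]; change m i * (c * _) = _; ring }
  refine ⟨L.mkContinuous |B| ?_, ?_⟩
  · intro x
    change ‖b.repr.symm _‖ ≤ _
    rw [LinearIsometryEquiv.norm_map, ← b.repr.norm_map x]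
    refine lp.norm_le_of_forall_sum_le (by norm_num) (by positivity) (fun s => ?_)
    rw [Real.mul_rpow (abs_nonneg _) (norm_nonneg _)]
    refine le_trans ?_ (mul_le_mul_of_nonneg_left
      (lp.sum_rpow_le_norm_rpow (by norm_num) (b.repr x) s) (by positivity))
    rw [Finset.mul_sum]
    refine Finset.sum_le_sum fun i _ => ?_
    rw [← Real.mul_rpow (abs_nonneg _) (norm_nonneg _)]
    refine Real.rpow_le_rpow (norm_nonneg _) ?_ (by norm_num)
    simp only [norm_mul, Real.norm_eq_abs]
    exact mul_le_mul_of_nonneg_right ((hB i).trans (le_abs_self B)) (abs_nonneg _)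
  · intro x i
    rw [← b.repr_apply_apply, ← b.repr_apply_apply]
    change b.repr (b.repr.symm _) i = _
    rw [LinearIsometryEquiv.apply_symm_apply]

/-- A compact self-adjoint nonnegative operator has exactly one positive square root. -/
theorem existsUnique_sqrt.{u} {H : Type u} [NormedAddCommGroup H] [InnerProductSpace ℝ H]
    [CompleteSpace H]
    (T : H →L[ℝ] H) (hc : IsCompactOperator T) (hT : T.IsPositive) :
    ∃! S : H →L[ℝ] H, S.IsPositive ∧ S ∘L S = T := by
  have hs : (T : H →ₗ[ℝ] H).IsSymmetric := hT.isSymmetric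
  obtain ⟨ι, b, d, hb⟩ := exists_eigenbasis T hc hs
  have hnorm : ∀ i, ‖b i‖ = 1 := fun i => b.orthonormal.1 i
  have hd0 : ∀ i, 0 ≤ d i := by
    intro i
    have h := hT.inner_nonneg_left (b i)
    rwa [hb, real_inner_smul_left, real_inner_self_eq_norm_sq, hnorm, one_pow, mul_one] at h
  have hdB : ∀ i, d i ≤ ‖T‖ := by
    intro i
    have h := T.le_opNorm (b i)
    rwa [hb, norm_smul, hnorm, mul_one, mul_one, Real.norm_of_nonneg (hd0 i)] at h
  obtain ⟨S, hS⟩ := exists_diagonal b (fun i => √(d i)) √‖T‖ (fun i => by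
    rw [abs_of_nonneg (Real.sqrt_nonneg _)]
    exact Real.sqrt_le_sqrt (hdB i))
  have hext : ∀ x y : H, (∀ i, inner ℝ (b i) x = inner ℝ (b i) y) → x = y := by
    intro x y h
    apply b.repr.injective
    ext i
    rw [b.repr_apply_apply, b.repr_apply_apply]
    exact h i
  have hSb : ∀ i, S (b i) = √(d i) • b i := by
    intro i
    apply hext
    intro j
    rw [hS, real_inner_smul_right]
    by_cases hij : j = i
    · rw [hij]
    · rw [b.orthonormal.2 hij, mul_zero, mul_zero]
  have hunique : ∀ S' : H →L[ℝ] H, S'.IsPositive ∧ S' ∘L S' = T → ∀ i,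
      S' (b i) = √(d i) • b i := by
    rintro S' ⟨hp, hsq⟩ i
    have hTS : ∀ x, S' (S' x) = T x := fun x => by rw [← hsq]; rfl
    have hsym : ∀ x y, inner ℝ (S' x) y = inner ℝ x (S' y) := hp.isSymmetric
    rcases (hd0 i).eq_or_lt with h0 | hpos
    · rw [← h0, Real.sqrt_zero, zero_smul, ← inner_self_eq_zero (𝕜 := ℝ), hsym, hTS, hb, ← h0,
        zero_smul, inner_zero_right]
    · set y := S' (b i) - √(d i) • b i with hy
      have h1 : S' y = -(√(d i) • y) := by
        rw [hy, map_sub, map_smul, hTS, hb, smul_sub, smul_smul, Real.mul_self_sqrt (hd0 i)]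
        abel
      have h2 := hp.inner_nonneg_left y
      rw [h1, inner_neg_left, real_inner_smul_left, real_inner_self_eq_norm_sq] at h2
      have h3 : 0 < √(d i) := Real.sqrt_pos.2 hpos
      have h4 : ‖y‖ ^ 2 ≤ 0 := by nlinarith [sq_nonneg ‖y‖]
      have h5 : y = 0 := by
        rw [← norm_eq_zero]; exact pow_eq_zero_iff (two_ne_zero) |>.1 (le_antisymm h4 (sq_nonneg _))
      exact sub_eq_zero.1 h5
  have hclm : ∀ S₁ S₂ : H →L[ℝ] H, (∀ i, S₁ (b i) = S₂ (b i)) → S₁ = S₂ := by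
    intro S₁ S₂ h
    refine ContinuousLinearMap.ext_on (s := Set.range b) ?_ ?_
    · rw [Submodule.dense_iff_topologicalClosure_eq_top]; exact b.dense_span
    · rintro _ ⟨i, rfl⟩; exact h i
  refine ⟨S, ⟨?_, ?_⟩, fun S' hS' => hclm _ _ fun i => by rw [hunique S' hS' i, hSb]⟩
  · refine (ContinuousLinearMap.isPositive_iff (T := S)).2 ⟨?_, ?_⟩
    · intro x y
      change inner ℝ (S x) y = inner ℝ x (S y)
      rw [← b.tsum_inner_mul_inner (S x) y, ← b.tsum_inner_mul_inner x (S y)]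
      refine tsum_congr fun i => ?_
      rw [hS, real_inner_comm, hS, real_inner_comm x]; ring
    · intro x
      change 0 ≤ inner ℝ (S x) x
      rw [← b.tsum_inner_mul_inner (S x) x]
      refine tsum_nonneg fun i => ?_
      rw [real_inner_comm, hS, mul_assoc]
      exact mul_nonneg (Real.sqrt_nonneg _) (mul_self_nonneg _)
  · refine hclm _ _ fun i => ?_
    rw [ContinuousLinearMap.comp_apply, hSb, map_smul, hSb, smul_smul,
      Real.mul_self_sqrt (hd0 i), hb]

/-- A covariance operator `T = 𝒜⁻¹` on a real Hilbert space: compact, self-adjoint and positive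
definite. -/
structure IsCovarianceOperator {H : Type*} [NormedAddCommGroup H] [InnerProductSpace ℝ H]
    (T : H →L[ℝ] H) : Prop where
  compact : IsCompactOperator T
  symmetric : (T : H →ₗ[ℝ] H).IsSymmetric
  pos : ∀ x : H, x ≠ 0 → 0 < inner ℝ (T x) x

theorem IsCovarianceOperator.isPositive {H : Type*} [NormedAddCommGroup H] [InnerProductSpace ℝ H]
    {T : H →L[ℝ] H} (hT : IsCovarianceOperator T) : T.IsPositive := by
  refine (ContinuousLinearMap.isPositive_iff T).2 ⟨hT.symmetric, fun x => ?_⟩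
  by_cases hx : x = 0
  · simp [hx]
  · exact (hT.pos x hx).le

/-- `𝒜^{-1/2}`: the positive square root of `T = 𝒜⁻¹`. -/
noncomputable def invSqrt {H : Type*} [NormedAddCommGroup H] [InnerProductSpace ℝ H]
    (T : H →L[ℝ] H) : H →L[ℝ] H :=
  Classical.epsilon fun S : H →L[ℝ] H => S.IsPositive ∧ S ∘L S = T

theorem invSqrt_spec {H : Type*} [NormedAddCommGroup H] [InnerProductSpace ℝ H] [CompleteSpace H]
    {T : H →L[ℝ] H} (hT : IsCovarianceOperator T) :
    (invSqrt T).IsPositive ∧ invSqrt T ∘L invSqrt T = T :=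
  Classical.epsilon_spec (existsUnique_sqrt T hT.compact hT.isPositive).exists

theorem invSqrt_injective {H : Type*} [NormedAddCommGroup H] [InnerProductSpace ℝ H]
    [CompleteSpace H] {T : H →L[ℝ] H} (hT : IsCovarianceOperator T) :
    Function.Injective (invSqrt T) := by
  rw [injective_iff_map_eq_zero]
  intro x hx
  by_contra hne
  have h := hT.pos x hne
  rw [← (invSqrt_spec hT).2, ContinuousLinearMap.comp_apply, hx, map_zero, inner_zero_left] at h
  exact lt_irrefl _ h

/-- The unbounded operator `𝒜^{1/2}`, the inverse of `𝒜^{-1/2}`. Its domain is the range of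
`𝒜^{-1/2}`, i.e. the Cameron–Martin space `V = D(𝒜^{1/2})`. -/
noncomputable def precisionSqrt {H : Type*} [NormedAddCommGroup H] [InnerProductSpace ℝ H]
    (T : H →L[ℝ] H) : H →ₗ.[ℝ] H :=
  ((invSqrt T : H →ₗ[ℝ] H).toPMap ⊤).inverse

/-- The energy form `a(u, v) = ⟨𝒜^{1/2} u, 𝒜^{1/2} v⟩_H` on `V = D(𝒜^{1/2})`. -/
noncomputable def energyForm {H : Type*} [NormedAddCommGroup H] [InnerProductSpace ℝ H]
    (T : H →L[ℝ] H) (u v : (precisionSqrt T).domain) : ℝ :=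
  inner ℝ (precisionSqrt T u) (precisionSqrt T v)

/-! ### Nested discretisation spaces -/

/-- A nested sequence `V₀ ⊆ V₁ ⊆ ⋯ ⊆ V` of finite dimensional subspaces, each with a basis
`φ ℓ : Fin (n ℓ) → V`; the space `V_ℓ` is the span of `φ ℓ`. -/
structure Hierarchy {H : Type*} [NormedAddCommGroup H] [InnerProductSpace ℝ H]
    (T : H →L[ℝ] H) where
  n : ℕ → ℕ
  φ : ∀ ℓ, Fin (n ℓ) → (precisionSqrt T).domain
  linearIndependent : ∀ ℓ, LinearIndependent ℝ (φ ℓ)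
  nested : ∀ ℓ, Submodule.span ℝ (Set.range (φ ℓ)) ≤ Submodule.span ℝ (Set.range (φ (ℓ + 1)))

/-- The space `ℝ^k` of coefficient vectors, with the Euclidean norm. -/
abbrev Vec (k : ℕ) : Type := EuclideanSpace ℝ (Fin k)

/-- Square real matrices. -/
abbrev Mat (k : ℕ) : Type := Matrix (Fin k) (Fin k) ℝ

namespace Hierarchy

/-- `P_ℓ x = ∑ j, x_j φ_j^ℓ`, as an element of `H`. -/
noncomputable def P {H : Type*} [NormedAddCommGroup H] [InnerProductSpace ℝ H] {T : H →L[ℝ] H}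
    (𝓗 : Hierarchy T) (ℓ : ℕ) (x : Vec (𝓗.n ℓ)) : H :=
  ∑ j, x j • (𝓗.φ ℓ j : H)

/-- The precision matrix `(A_ℓ)_{jk} = a(φ_j^ℓ, φ_k^ℓ)`. -/
noncomputable def A {H : Type*} [NormedAddCommGroup H] [InnerProductSpace ℝ H] {T : H →L[ℝ] H}
    (𝓗 : Hierarchy T) (ℓ : ℕ) : Mat (𝓗.n ℓ) :=
  Matrix.of fun j k => energyForm T (𝓗.φ ℓ j) (𝓗.φ ℓ k)

/-- The canonical prolongation from level `ℓ` to level `ℓ + 1`: the matrix of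
`P_{ℓ+1}⁻¹ P_ℓ`, whose `k`-th column holds the coefficients of `φ_k^ℓ` in the basis of
`V_{ℓ+1}`. -/
noncomputable def prolongation {H : Type*} [NormedAddCommGroup H] [InnerProductSpace ℝ H]
    {T : H →L[ℝ] H} (𝓗 : Hierarchy T) (ℓ : ℕ) :
    Matrix (Fin (𝓗.n (ℓ + 1))) (Fin (𝓗.n ℓ)) ℝ :=
  Matrix.of fun j k =>
    (Module.Basis.span (𝓗.linearIndependent (ℓ + 1))).repr
      ⟨𝓗.φ ℓ k, 𝓗.nested ℓ (Submodule.subset_span ⟨k, rfl⟩)⟩ j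

/-- The dual coefficient vector `(g_ℓ)_j = ⟨g, φ_j^ℓ⟩_H` of `g ∈ H`. It is used for the right-hand
side `f` and for the quantity of interest `𝓕 = ⟨·, χ⟩_H`. -/
noncomputable def dualVec {H : Type*} [NormedAddCommGroup H] [InnerProductSpace ℝ H]
    {T : H →L[ℝ] H} (𝓗 : Hierarchy T) (ℓ : ℕ) (g : H) : Vec (𝓗.n ℓ) :=
  WithLp.toLp 2 fun j => inner ℝ g (𝓗.φ ℓ j : H)

/-- There are a decreasing `Φ : ℕ → [0, ∞)` and level-independent constants `c₁, c₂ > 0` with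
`c₁ ‖P_ℓ x‖_H ≤ Φ(ℓ) ‖x‖₂ ≤ c₂ ‖P_ℓ x‖_H`. -/
def BasisScaling {H : Type*} [NormedAddCommGroup H] [InnerProductSpace ℝ H] {T : H →L[ℝ] H}
    (𝓗 : Hierarchy T) : Prop :=
  ∃ Φ : ℕ → ℝ, Antitone Φ ∧ (∀ ℓ, 0 ≤ Φ ℓ) ∧ ∃ c₁ > 0, ∃ c₂ > 0, ∀ ℓ (x : Vec (𝓗.n ℓ)),
    c₁ * ‖𝓗.P ℓ x‖ ≤ Φ ℓ * ‖x‖ ∧ Φ ℓ * ‖x‖ ≤ c₂ * ‖𝓗.P ℓ x‖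

end Hierarchy

/-! ### Matrix norms, smoothing property, approximation property -/

/-- The spectral norm `‖B‖₂` of a square matrix. -/
noncomputable def norm₂ {k : ℕ} (B : Mat k) : ℝ :=
  ‖Matrix.toEuclideanCLM (n := Fin k) (𝕜 := ℝ) B‖

open scoped MatrixOrder in
/-- The positive semidefinite square root `B^{1/2}` of a positive semidefinite matrix. -/
noncomputable def msqrt {k : ℕ} (B : Mat k) : Mat k :=
  CFC.sqrt B

/-- `M` is a symmetric splitting matrix with `0 < A ≤ M` in the Loewner order. -/
def SmoothingProperty {k : ℕ} (A M : Mat k) : Prop :=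
  M.IsSymm ∧ A.PosDef ∧ (M - A).PosSemidef

/-- `‖M_ℓ^{1/2} (A_ℓ⁻¹ - I A_{ℓ-1}⁻¹ Iᵀ) M_ℓ^{1/2}‖₂ ≤ C_A` on all levels `ℓ ≥ 1`, where `I` is the
prolongation from level `ℓ - 1` to level `ℓ`. -/
def ApproximationProperty {H : Type*} [NormedAddCommGroup H] [InnerProductSpace ℝ H]
    {T : H →L[ℝ] H} (𝓗 : Hierarchy T) (M : ∀ ℓ, Mat (𝓗.n ℓ)) (C_A : ℝ) : Prop :=
  ∀ ℓ, norm₂ (msqrt (M (ℓ + 1)) *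
    ((𝓗.A (ℓ + 1))⁻¹ - 𝓗.prolongation ℓ * (𝓗.A ℓ)⁻¹ * (𝓗.prolongation ℓ).transpose) *
    msqrt (M (ℓ + 1))) ≤ C_A

/-! ### The Multigrid Monte Carlo update -/

/-- One step of the random smoother with splitting matrix `M`, with the random vector `ξ` as an
argument: `θ ↦ θ + M⁻¹ (f + ξ - A θ)`. -/
noncomputable def randomSmoother {k : ℕ} (A M : Mat k) (f ξ θ : Vec k) : Vec k :=
  θ + Matrix.toEuclideanLin M⁻¹ (f + ξ - Matrix.toEuclideanLin A θ)

/-- `ν` steps of the random smoother, started in `θ`; step `j` uses the random vector `ξ j`. -/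
noncomputable def smooth {k : ℕ} (A M : Mat k) (f : Vec k) (ξ : ℕ → Vec k) (θ : Vec k) :
    ℕ → Vec k
  | 0 => θ
  | ν + 1 => randomSmoother A M f (ξ ν) (smooth A M f ξ θ ν)

/-- Labels of the random vectors drawn in one V-cycle: the draw of the coarsest level sampler, and
the draws in step `j` of the pre- and of the post-smoother on level `ℓ`. -/
inductive Draw where
  | coarse : Draw
  | pre (ℓ j : ℕ) : Draw
  | post (ℓ j : ℕ) : Draw

/-- The level on which a draw takes place. -/
abbrev Draw.level : Draw → ℕ
  | .coarse => 0
  | .pre ℓ _ => ℓ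
  | .post ℓ _ => ℓ

/-- The draws that take place in a V-cycle with finest level `L`, `ν₁` pre- and `ν₂`
post-smoothing steps. -/
def Draw.Used (L ν₁ ν₂ : ℕ) : Draw → Prop
  | .coarse => True
  | .pre ℓ j => 1 ≤ ℓ ∧ ℓ ≤ L ∧ j < ν₁
  | .post ℓ j => 1 ≤ ℓ ∧ ℓ ≤ L ∧ j < ν₂

/-- The law of each draw: `𝒩(0, A₀⁻¹)` for the exact sampler on the coarsest level and
`𝒩(0, M + Mᵀ - A)` for a smoothing step with splitting matrix `M`. -/
noncomputable def drawLaw {n : ℕ → ℕ} (A Mpre Mpost : ∀ ℓ, Mat (n ℓ)) :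
    (i : Draw) → MeasureTheory.Measure (Vec (n i.level))
  | .coarse => ProbabilityTheory.multivariateGaussian 0 (A 0)⁻¹
  | .pre ℓ _ =>
      ProbabilityTheory.multivariateGaussian 0 (Mpre ℓ + (Mpre ℓ).transpose - A ℓ)
  | .post ℓ _ =>
      ProbabilityTheory.multivariateGaussian 0 (Mpost ℓ + (Mpost ℓ).transpose - A ℓ)

/-- The Multigrid Monte Carlo update `θ ↦ MGMC_ℓ(A_ℓ, f, θ)` for the V-cycle (one recursive call per
level) with an exact sampler on level `0`, as a function of the random vectors `ξ` that are drawn on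
the way. On level `0` the new state is `A₀⁻¹ f + ξ` with `ξ ∼ 𝒩(0, A₀⁻¹)`, i.e. a draw
from `𝒩(A₀⁻¹ f, A₀⁻¹)`. -/
noncomputable def mgmc {n : ℕ → ℕ} (A Mpre Mpost : ∀ ℓ, Mat (n ℓ))
    (I : ∀ ℓ, Matrix (Fin (n (ℓ + 1))) (Fin (n ℓ)) ℝ) (ν₁ ν₂ : ℕ)
    (ξ : (i : Draw) → Vec (n i.level)) : (ℓ : ℕ) → Vec (n ℓ) → Vec (n ℓ) → Vec (n ℓ)
  | 0, f, _ =>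
      let w : Vec (n 0) := ξ .coarse
      Matrix.toEuclideanLin (A 0)⁻¹ f + w
  | ℓ + 1, f, θ =>
      let θ₁ := smooth (A (ℓ + 1)) (Mpre (ℓ + 1)) f (fun j => ξ (.pre (ℓ + 1) j)) θ ν₁
      let f' := Matrix.toEuclideanLin (I ℓ).transpose
        (f - Matrix.toEuclideanLin (A (ℓ + 1)) θ₁)
      let ψ := mgmc A Mpre Mpost I ν₁ ν₂ ξ ℓ f' 0
      let θ₂ := θ₁ + Matrix.toEuclideanLin (I ℓ) ψ
      smooth (A (ℓ + 1)) (Mpost (ℓ + 1)) f (fun j => ξ (.post (ℓ + 1) j)) θ₂ ν₂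

/-- `θ 0, θ 1, …` is a Markov chain generated by the Multigrid Monte Carlo update on level `L` with
right-hand side `f`: the random vectors `ξ m i` drawn in step `m` have the prescribed normal laws,
all draws are mutually independent and independent of the initial state, and
`θ (m + 1) = MGMC_L(A_L, f, θ m)`. -/
structure IsMGMCChain {n : ℕ → ℕ} (A Mpre Mpost : ∀ ℓ, Mat (n ℓ))
    (I : ∀ ℓ, Matrix (Fin (n (ℓ + 1))) (Fin (n ℓ)) ℝ) (ν₁ ν₂ L : ℕ) (f : Vec (n L))
    {Ω : Type*} [MeasurableSpace Ω] (ℙ : MeasureTheory.Measure Ω) (θ : ℕ → Ω → Vec (n L))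
    (ξ : ℕ → (i : Draw) → Ω → Vec (n i.level)) : Prop where
  measurable_init : Measurable (θ 0)
  measurable_draw : ∀ m i, i.Used L ν₁ ν₂ → Measurable (ξ m i)
  law_draw : ∀ m i, i.Used L ν₁ ν₂ → ProbabilityTheory.HasLaw (ξ m i) (drawLaw A Mpre Mpost i) ℙ
  indep_draw : ProbabilityTheory.iIndepFun
    (fun (p : ℕ × {i : Draw // i.Used L ν₁ ν₂}) => ξ p.1 p.2.1) ℙ
  indep_init : ProbabilityTheory.IndepFun (θ 0)
    (fun ω (p : ℕ × {i : Draw // i.Used L ν₁ ν₂}) => ξ p.1 p.2.1 ω) ℙ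
  step : ∀ m ω, θ (m + 1) ω = mgmc A Mpre Mpost I ν₁ ν₂ (fun i => ξ m i ω) L f (θ m ω)

/-- The covariance matrix of a random vector. -/
noncomputable def covMatrix {k : ℕ} {Ω : Type*} [MeasurableSpace Ω]
    (ℙ : MeasureTheory.Measure Ω) (X : Ω → Vec k) : Mat k :=
  Matrix.of fun i j => ProbabilityTheory.covariance (fun ω => X ω i) (fun ω => X ω j) ℙ

/-! ### The Monte Carlo estimator -/

/-- The quantity of interest `I(F) = 𝔼[Fᵀ θ]` for `θ ∼ 𝒩(A⁻¹ f, A⁻¹)`. -/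
noncomputable def exactValue {k : ℕ} (A : Mat k) (f F : Vec k) : ℝ :=
  ∫ x, inner ℝ F x
    ∂(ProbabilityTheory.multivariateGaussian (Matrix.toEuclideanLin A⁻¹ f) A⁻¹)

/-- The Monte Carlo estimator `(1/M) ∑_{m=1}^M Fᵀ θ^{(m)}`. -/
noncomputable def estimator {k : ℕ} {Ω : Type*} (F : Vec k) (θ : ℕ → Ω → Vec k) (M : ℕ) (ω : Ω) :
    ℝ :=
  (1 / (M : ℝ)) * ∑ m ∈ Finset.Icc 1 M, inner ℝ F (θ m ω)

end MGMC

/-! The chain is a linear autoregressive process. One V-cycle is affine in the state with fixed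
point `A⁻¹ f` for its mean, so the error `e = θ - A⁻¹ f` satisfies `e (m+1) = X e m + w m`, where
`X` is the deterministic multigrid error propagation matrix and `w m` is built from the fresh draws
alone (`mgmc_sub`). Two facts about `X` carry the proof.

Contraction: with equally many pre- and post-smoothing steps `X A⁻¹` is positive semidefinite, and
the smoothing and approximation properties give `X A⁻¹ ≤ ρ A⁻¹` with `ρ = C_A / (C_A + ν)`, the same
on every level (`quadForm_vcycleMat_mul_inv_le`). By Cauchy–Schwarz `Xᵀ` then contracts the
`A⁻¹`-norm by the factor `ρ` (`quadForm_inv_transpose_vcycleMat_le`).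

Invariance: each smoothing step and each coarse correction preserves the covariance `A⁻¹`, so `w m`
has second moment `A⁻¹ - X A⁻¹ Xᵀ` (`secondMoment_noise`).

Hence second moments of `e m` stay below `d A⁻¹`, correlations in time decay like powers of `ρ`, and
the second moment of `∑ Fᵀ e m` over `M` steps is at most `2 M d Fᵀ A⁻¹ F / (1 - ρ)`
(`integral_sum_sq_le`). Second moments are not centred, so bias and variance are handled together.
The level enters only through `Fᵀ A⁻¹ F` and `d`. The former is the squared energy norm of a
Galerkin solution, bounded through `𝒜^{-1/2}` (`quadForm_inv_dualVec_le`); the same bound for `f`,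
with the assumptions on the initial state, controls `d` (`integral_inner_sub_sq_le`). -/

namespace MGMC

open Matrix

/-! ### Quadratic forms and Loewner bounds -/

/-- The quadratic form `pᵀ W p`. -/
noncomputable def quadForm {k : ℕ} (W : Mat k) (p : Fin k → ℝ) : ℝ := p ⬝ᵥ W *ᵥ p

theorem quadForm_add {k : ℕ} (W W' : Mat k) (p : Fin k → ℝ) :
    quadForm (W + W') p = quadForm W p + quadForm W' p := by
  simp [quadForm, add_mulVec]

theorem quadForm_sub {k : ℕ} (W W' : Mat k) (p : Fin k → ℝ) :
    quadForm (W - W') p = quadForm W p - quadForm W' p := by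
  simp [quadForm, sub_mulVec]

theorem quadForm_zero {k : ℕ} (p : Fin k → ℝ) : quadForm (0 : Mat k) p = 0 := by
  simp [quadForm]

theorem quadForm_conj {k l : ℕ} (B : Matrix (Fin k) (Fin l) ℝ) (W : Mat l) (p : Fin k → ℝ) :
    quadForm (B * W * Bᵀ) p = quadForm W (Bᵀ *ᵥ p) := by
  rw [quadForm, quadForm, ← mulVec_mulVec, ← mulVec_mulVec, dotProduct_mulVec, ← mulVec_transpose]

theorem quadForm_nonneg {k : ℕ} {W : Mat k} (hW : W.PosSemidef) (p : Fin k → ℝ) :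
    0 ≤ quadForm W p := by
  simpa [quadForm] using hW.dotProduct_mulVec_nonneg p

theorem posSemidef_conj {k l : ℕ} {W : Mat l} (hW : W.PosSemidef)
    (B : Matrix (Fin k) (Fin l) ℝ) : (B * W * Bᵀ).PosSemidef := by
  simpa using hW.mul_mul_conjTranspose_same B

theorem isSymm_of_posSemidef {k : ℕ} {W : Mat k} (hW : W.PosSemidef) : Wᵀ = W := by
  simpa using hW.isHermitian.eq

/-- The Cauchy–Schwarz inequality for a positive semidefinite matrix. -/
theorem sq_dotProduct_mulVec_le {k : ℕ} {W : Mat k} (hW : W.PosSemidef) (p q : Fin k → ℝ) :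
    (p ⬝ᵥ W *ᵥ q) ^ 2 ≤ quadForm W p * quadForm W q := by
  have hsymm : q ⬝ᵥ W *ᵥ p = p ⬝ᵥ W *ᵥ q := by
    rw [dotProduct_comm, ← vecMul_transpose, isSymm_of_posSemidef hW, ← dotProduct_mulVec]
  have h : ∀ t : ℝ, 0 ≤ quadForm W q * (t * t) + 2 * (p ⬝ᵥ W *ᵥ q) * t + quadForm W p := by
    intro t
    have := quadForm_nonneg hW (p + t • q)
    simp only [quadForm, mulVec_add, mulVec_smul, dotProduct_add, add_dotProduct, smul_dotProduct,
      dotProduct_smul, smul_eq_mul, hsymm] at this ⊢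
    linarith
  have := discrim_le_zero h
  rw [discrim] at this
  nlinarith

/-! ### The smoother -/

/-- The error propagation matrix `1 - M⁻¹ A` of the smoother. -/
noncomputable def smootherMat {k : ℕ} (A M : Mat k) : Mat k := 1 - M⁻¹ * A

namespace SmoothingProperty

variable {k : ℕ} {A M : Mat k}

theorem posDef_right (h : SmoothingProperty A M) : M.PosDef := by
  have := h.2.1.add_posSemidef h.2.2
  simpa using this

theorem inv_mul (h : SmoothingProperty A M) : M⁻¹ * M = 1 :=
  nonsing_inv_mul _ ((isUnit_iff_isUnit_det _).1 h.posDef_right.isUnit)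

theorem isSymm_inv (h : SmoothingProperty A M) : (M⁻¹)ᵀ = M⁻¹ :=
  isSymm_of_posSemidef h.posDef_right.inv.posSemidef

end SmoothingProperty

theorem inv_mul_of_posDef {k : ℕ} {A : Mat k} (h : A.PosDef) : A⁻¹ * A = 1 :=
  nonsing_inv_mul _ ((isUnit_iff_isUnit_det _).1 h.isUnit)

theorem mul_inv_of_posDef {k : ℕ} {A : Mat k} (h : A.PosDef) : A * A⁻¹ = 1 :=
  mul_nonsing_inv _ ((isUnit_iff_isUnit_det _).1 h.isUnit)

theorem pow_mul_eq_mul_transpose_pow {k : ℕ} {R N : Mat k} (h : R * N = N * Rᵀ) (j : ℕ) :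
    R ^ j * N = N * (R ^ j)ᵀ := by
  rw [transpose_pow]
  exact ((show SemiconjBy N Rᵀ R from h.symm).pow_right j).eq.symm

theorem pow_two_mul_mul {k : ℕ} {R N : Mat k} (h : R * N = N * Rᵀ) (j : ℕ) :
    R ^ (2 * j) * N = R ^ j * N * (R ^ j)ᵀ := by
  rw [two_mul, pow_add, Matrix.mul_assoc, Matrix.mul_assoc, ← pow_mul_eq_mul_transpose_pow h]

/-- Half of the factors `R` can be moved to the right of `N` as transposes. This leaves a congruence
of `N` for even `j` and of `R * N` for odd `j`, so no spectral theorem is needed. -/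
theorem posSemidef_pow_mul {k : ℕ} {R N : Mat k} (h : R * N = N * Rᵀ) (h0 : N.PosSemidef)
    (h1 : (R * N).PosSemidef) (j : ℕ) : (R ^ j * N).PosSemidef := by
  obtain ⟨i, rfl | rfl⟩ := Nat.even_or_odd' j
  · rw [pow_two_mul_mul h]
    exact posSemidef_conj h0 _
  · rw [pow_succ, Matrix.mul_assoc, pow_two_mul_mul]
    · exact posSemidef_conj h1 _
    · rw [h, ← Matrix.mul_assoc, h]

namespace SmoothingProperty

variable {k : ℕ} {A M : Mat k}

theorem transpose_smootherMat (h : SmoothingProperty A M) :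
    (smootherMat A M)ᵀ = 1 - A * M⁻¹ := by
  rw [smootherMat, transpose_sub, transpose_mul, h.isSymm_inv,
    isSymm_of_posSemidef h.2.1.posSemidef, transpose_one]

theorem smootherMat_mul_inv (h : SmoothingProperty A M) :
    smootherMat A M * A⁻¹ = A⁻¹ - M⁻¹ := by
  rw [smootherMat, Matrix.sub_mul, Matrix.mul_assoc, mul_inv_of_posDef h.2.1]; simp

theorem smootherMat_mul_inv_comm (h : SmoothingProperty A M) :
    smootherMat A M * A⁻¹ = A⁻¹ * (smootherMat A M)ᵀ := by
  rw [h.smootherMat_mul_inv, h.transpose_smootherMat, Matrix.mul_sub, ← Matrix.mul_assoc,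
    inv_mul_of_posDef h.2.1]; simp

theorem smootherMat_mul_conj_inv (h : SmoothingProperty A M) :
    smootherMat A M * (M⁻¹ * A * M⁻¹) = M⁻¹ * A * M⁻¹ * (smootherMat A M)ᵀ := by
  rw [h.transpose_smootherMat, smootherMat]
  noncomm_ring

theorem posSemidef_conj_inv (h : SmoothingProperty A M) : (M⁻¹ * A * M⁻¹).PosSemidef := by
  simpa only [h.isSymm_inv] using posSemidef_conj h.2.1.posSemidef M⁻¹

/-- With `t = M^{-1/2} A M^{-1/2}` this is `(1 - t) t ≥ 0` for `0 ≤ t ≤ 1`. The identity `(1 - t) t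
= (1 - t) t (1 - t) + t (1 - t) t` makes it a sum of congruences of `A` and of `M - A`. -/
theorem posSemidef_smootherMat_mul_conj_inv (h : SmoothingProperty A M) :
    (smootherMat A M * (M⁻¹ * A * M⁻¹)).PosSemidef := by
  have e : smootherMat A M * (M⁻¹ * A * M⁻¹) =
      (M⁻¹ * (smootherMat A M)ᵀ) * A * (M⁻¹ * (smootherMat A M)ᵀ)ᵀ +
      (M⁻¹ * A * M⁻¹) * (M - A) * (M⁻¹ * A * M⁻¹)ᵀ := by
    have e1 : (M⁻¹ * A * M⁻¹) * (M - A) = M⁻¹ * A - M⁻¹ * A * M⁻¹ * A := by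
      rw [Matrix.mul_sub, Matrix.mul_assoc (M⁻¹ * A), h.inv_mul, Matrix.mul_one]
    rw [e1, transpose_mul, transpose_transpose, isSymm_of_posSemidef h.posSemidef_conj_inv,
      h.isSymm_inv, h.transpose_smootherMat, smootherMat]
    noncomm_ring
  rw [e]
  exact (posSemidef_conj h.2.1.posSemidef _).add (posSemidef_conj h.2.2 _)

/-- The smoothing estimate `ν ⟨(1 - R) R^ν A⁻¹ p, p⟩ ≤ ⟨(1 - R^ν) A⁻¹ p, p⟩`. -/
theorem mul_quadForm_le (h : SmoothingProperty A M) (ν : ℕ) (p : Fin k → ℝ) :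
    ν * quadForm (smootherMat A M ^ ν * M⁻¹) p ≤
      quadForm A⁻¹ p - quadForm (smootherMat A M ^ ν * A⁻¹) p := by
  set R := smootherMat A M with hR
  have hstep : ∀ j, R ^ (j + 1) * A⁻¹ = R ^ j * A⁻¹ - R ^ j * M⁻¹ := fun j => by
    rw [pow_succ, Matrix.mul_assoc, h.smootherMat_mul_inv, Matrix.mul_sub]
  -- Consecutive terms differ by the form of `R ^ j * (M⁻¹ A M⁻¹)`, which is nonnegative.
  have hanti : Antitone fun j => quadForm (R ^ j * M⁻¹) p := by
    refine antitone_nat_of_succ_le fun j => ?_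
    have e : R ^ (j + 1) * M⁻¹ = R ^ j * M⁻¹ - R ^ j * (M⁻¹ * A * M⁻¹) := by
      rw [pow_succ, hR, smootherMat]; noncomm_ring
    have := quadForm_nonneg (posSemidef_pow_mul h.smootherMat_mul_conj_inv h.posSemidef_conj_inv
      h.posSemidef_smootherMat_mul_conj_inv j) p
    rw [e, quadForm_sub]
    linarith
  -- Telescoping, by `R A⁻¹ = A⁻¹ - M⁻¹`; each of the first `ν` summands is at least the term with
  -- index `ν`.
  have hsum : ∀ j, quadForm A⁻¹ p - quadForm (R ^ j * A⁻¹) p =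
      ∑ i ∈ Finset.range j, quadForm (R ^ i * M⁻¹) p := by
    intro j
    induction j with
    | zero => simp
    | succ j ih => rw [Finset.sum_range_succ, ← ih, hstep, quadForm_sub]; ring
  rw [hsum, ← nsmul_eq_mul, ← Finset.card_range ν, ← Finset.sum_const, Finset.card_range]
  exact Finset.sum_le_sum fun i hi => hanti (Finset.mem_range.1 hi).le

end SmoothingProperty

/-! ### The V-cycle -/

/-- A multigrid hierarchy: positive definite Galerkin matrices `A ℓ`, splitting matrices `M ℓ` with
the smoothing property and the approximation property with constant `c`. -/
structure IsMultigrid {n : ℕ → ℕ} (A M : ∀ ℓ, Mat (n ℓ))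
    (I : ∀ ℓ, Matrix (Fin (n (ℓ + 1))) (Fin (n ℓ)) ℝ) (c : ℝ) : Prop where
  posDef : ∀ ℓ, (A ℓ).PosDef
  smoothing : ∀ ℓ, SmoothingProperty (A (ℓ + 1)) (M (ℓ + 1))
  galerkin : ∀ ℓ, (I ℓ)ᵀ * A (ℓ + 1) * I ℓ = A ℓ
  approximation : ∀ ℓ p, quadForm ((A (ℓ + 1))⁻¹ - I ℓ * (A ℓ)⁻¹ * (I ℓ)ᵀ) p ≤
    c * quadForm (M (ℓ + 1))⁻¹ p

/-- The matrix by which the coarse grid correction changes the error if the system on the coarser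
level is solved up to an error with propagation matrix `X`. -/
noncomputable def coarseMat {n : ℕ → ℕ} (A : ∀ ℓ, Mat (n ℓ))
    (I : ∀ ℓ, Matrix (Fin (n (ℓ + 1))) (Fin (n ℓ)) ℝ) (ℓ : ℕ) (X : Mat (n ℓ)) : Mat (n (ℓ + 1)) :=
  1 - I ℓ * ((1 - X) * ((A ℓ)⁻¹ * ((I ℓ)ᵀ * A (ℓ + 1))))

/-- The error propagation matrix of the V-cycle with `μ` pre- and `μ` post-smoothing steps. -/
noncomputable def vcycleMat {n : ℕ → ℕ} (A M : ∀ ℓ, Mat (n ℓ))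
    (I : ∀ ℓ, Matrix (Fin (n (ℓ + 1))) (Fin (n ℓ)) ℝ) (μ : ℕ) : ∀ ℓ, Mat (n ℓ)
  | 0 => 0
  | ℓ + 1 => smootherMat (A (ℓ + 1)) (M (ℓ + 1)) ^ μ * (coarseMat A I ℓ (vcycleMat A M I μ ℓ) *
      smootherMat (A (ℓ + 1)) (M (ℓ + 1)) ^ μ)

namespace IsMultigrid

variable {n : ℕ → ℕ} {A M : ∀ ℓ, Mat (n ℓ)}
  {I : ∀ ℓ, Matrix (Fin (n (ℓ + 1))) (Fin (n ℓ)) ℝ} {c : ℝ}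

theorem coarseMat_mul_inv (h : IsMultigrid A M I c) (ℓ : ℕ) (X : Mat (n ℓ)) :
    coarseMat A I ℓ X * (A (ℓ + 1))⁻¹ = (A (ℓ + 1))⁻¹ - I ℓ * (A ℓ)⁻¹ * (I ℓ)ᵀ +
      I ℓ * (X * (A ℓ)⁻¹) * (I ℓ)ᵀ := by
  have := mul_inv_of_posDef (h.posDef (ℓ + 1))
  simp only [coarseMat, Matrix.sub_mul, Matrix.mul_sub, Matrix.mul_assoc, this, Matrix.one_mul,
    Matrix.mul_one]
  abel

/-- Since `R A⁻¹ = A⁻¹ Rᵀ`, the pre-smoother passes through `A⁻¹` and becomes the transpose of the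
post-smoother. Equal numbers of steps thus turn the V-cycle into a congruence of the exact two-grid
defect plus the prolonged error of the coarse solve. -/
theorem vcycleMat_succ_mul_inv (h : IsMultigrid A M I c) (μ ℓ : ℕ) :
    vcycleMat A M I μ (ℓ + 1) * (A (ℓ + 1))⁻¹ = smootherMat (A (ℓ + 1)) (M (ℓ + 1)) ^ μ *
      ((A (ℓ + 1))⁻¹ - I ℓ * (A ℓ)⁻¹ * (I ℓ)ᵀ +
        I ℓ * (vcycleMat A M I μ ℓ * (A ℓ)⁻¹) * (I ℓ)ᵀ) *
      (smootherMat (A (ℓ + 1)) (M (ℓ + 1)) ^ μ)ᵀ := by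
  rw [← h.coarseMat_mul_inv, vcycleMat, Matrix.mul_assoc, Matrix.mul_assoc,
    pow_mul_eq_mul_transpose_pow (h.smoothing ℓ).smootherMat_mul_inv_comm]
  simp only [Matrix.mul_assoc]

/-- By the Galerkin identity `Π = I A_ℓ⁻¹ Iᵀ A` is an `A`-orthogonal projection, so the difference
is `(1 - Π) A⁻¹ (1 - Π)ᵀ`. -/
theorem posSemidef_coarse (h : IsMultigrid A M I c) (ℓ : ℕ) :
    ((A (ℓ + 1))⁻¹ - I ℓ * (A ℓ)⁻¹ * (I ℓ)ᵀ).PosSemidef := by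
  have e : (A (ℓ + 1))⁻¹ - I ℓ * (A ℓ)⁻¹ * (I ℓ)ᵀ =
      (1 - I ℓ * (A ℓ)⁻¹ * (I ℓ)ᵀ * A (ℓ + 1)) * (A (ℓ + 1))⁻¹ *
        (1 - I ℓ * (A ℓ)⁻¹ * (I ℓ)ᵀ * A (ℓ + 1))ᵀ := by
    have h1 := mul_inv_of_posDef (h.posDef (ℓ + 1))
    have h2 := inv_mul_of_posDef (h.posDef (ℓ + 1))
    have h3 := inv_mul_of_posDef (h.posDef ℓ)
    have h4 := h.galerkin ℓ
    have h5 := isSymm_of_posSemidef (h.posDef ℓ).inv.posSemidef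
    have h6 := isSymm_of_posSemidef (h.posDef (ℓ + 1)).posSemidef
    have h7 : (1 - I ℓ * (A ℓ)⁻¹ * (I ℓ)ᵀ * A (ℓ + 1)) * (A (ℓ + 1))⁻¹ =
      (A (ℓ + 1))⁻¹ - I ℓ * (A ℓ)⁻¹ * (I ℓ)ᵀ := by
      rw [Matrix.sub_mul, Matrix.mul_assoc _ (A (ℓ + 1)), h1]; simp
    have h8 : I ℓ * (A ℓ)⁻¹ * (I ℓ)ᵀ * (A (ℓ + 1) * (I ℓ * (A ℓ)⁻¹ * (I ℓ)ᵀ)) =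
        I ℓ * (A ℓ)⁻¹ * (I ℓ)ᵀ := by
      calc _ = I ℓ * (A ℓ)⁻¹ * (((I ℓ)ᵀ * A (ℓ + 1) * I ℓ) * (A ℓ)⁻¹ * (I ℓ)ᵀ) := by
            simp only [Matrix.mul_assoc]
        _ = I ℓ * (((A ℓ)⁻¹ * A ℓ) * (A ℓ)⁻¹) * (I ℓ)ᵀ := by
            rw [h4]; simp only [Matrix.mul_assoc]
        _ = _ := by rw [h3, Matrix.one_mul]
    rw [h7, transpose_sub, transpose_mul, transpose_mul, transpose_mul, transpose_transpose,
      transpose_one, h5, h6, Matrix.mul_sub, Matrix.mul_one, Matrix.sub_mul,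
      ← Matrix.mul_assoc (A (ℓ + 1))⁻¹, h2, Matrix.one_mul, ← Matrix.mul_assoc (I ℓ), h8, sub_self,
      sub_zero]
  rw [e]
  exact posSemidef_conj (h.posDef (ℓ + 1)).inv.posSemidef _

theorem posSemidef_vcycleMat_mul_inv (h : IsMultigrid A M I c) (μ ℓ : ℕ) :
    (vcycleMat A M I μ ℓ * (A ℓ)⁻¹).PosSemidef := by
  induction ℓ with
  | zero => rw [vcycleMat, Matrix.zero_mul]; exact PosSemidef.zero
  | succ ℓ ih =>
    rw [h.vcycleMat_succ_mul_inv]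
    exact posSemidef_conj ((h.posSemidef_coarse ℓ).add (posSemidef_conj ih _)) _

/-- The V-cycle convergence theorem: the energy contraction rate is at most `c / (c + 2 μ)`. -/
theorem quadForm_vcycleMat_mul_inv_le (h : IsMultigrid A M I c) (hc : 0 < c) {μ : ℕ} (hμ : 0 < μ)
    (ℓ : ℕ) (p : Fin (n ℓ) → ℝ) :
    quadForm (vcycleMat A M I μ ℓ * (A ℓ)⁻¹) p ≤ c / (c + 2 * μ) * quadForm (A ℓ)⁻¹ p := by
  have hμ' : (0 : ℝ) < μ := by exact_mod_cast hμ
  induction ℓ with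
  | zero =>
    rw [vcycleMat, Matrix.zero_mul, quadForm_zero]
    exact mul_nonneg (by positivity) (quadForm_nonneg (h.posDef 0).inv.posSemidef p)
  | succ ℓ ih =>
    have hs := h.smoothing ℓ
    have h1 := hs.mul_quadForm_le (2 * μ) p
    set R := smootherMat (A (ℓ + 1)) (M (ℓ + 1)) with hR
    have hcomm : R * (M (ℓ + 1))⁻¹ = (M (ℓ + 1))⁻¹ * Rᵀ := by
      rw [hs.transpose_smootherMat, hR, smootherMat]; noncomm_ring
    rw [pow_two_mul_mul hcomm, pow_two_mul_mul hs.smootherMat_mul_inv_comm, quadForm_conj,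
      quadForm_conj] at h1
    rw [h.vcycleMat_succ_mul_inv, quadForm_conj, quadForm_add, quadForm_conj]
    set s := (R ^ μ)ᵀ *ᵥ p
    have h2 := h.approximation ℓ s
    have h3 := ih ((I ℓ)ᵀ *ᵥ s)
    have h4 := quadForm_sub (A (ℓ + 1))⁻¹ (I ℓ * (A ℓ)⁻¹ * (I ℓ)ᵀ) s
    rw [quadForm_conj] at h4
    set ρ := c / (c + 2 * μ) with hρ
    -- This balance determines `ρ`. Let `a` and `b` be the values at `s` of `A⁻¹` and of its coarse
    -- part. Induction bounds the form by `(a - b) + ρ b = (1 - ρ) (a - b) + ρ a`, approximation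
    -- bounds this by `ρ (2 μ M⁻¹[s] + a)`, and the smoothing estimate with `2 μ` steps finishes.
    have h5 : (1 - ρ) * c = ρ * (2 * μ) := by rw [hρ]; field_simp; ring
    have h6 : 0 ≤ ρ := by positivity
    have h7 : 0 ≤ 1 - ρ := by
      rw [hρ, sub_nonneg, div_le_one (by positivity)]; linarith
    push_cast at h1
    have h8 := mul_le_mul_of_nonneg_left h2 h7
    have h9 := mul_le_mul_of_nonneg_left h1 h6
    rw [← mul_assoc, h5] at h8
    nlinarith

theorem mul_conj_vcycleMat (h : IsMultigrid A M I c) (μ ℓ : ℕ) :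
    vcycleMat A M I μ ℓ * (A ℓ)⁻¹ = (A ℓ)⁻¹ * (vcycleMat A M I μ ℓ)ᵀ := by
  have := isSymm_of_posSemidef (h.posSemidef_vcycleMat_mul_inv μ ℓ)
  rw [← this, transpose_mul, isSymm_of_posSemidef (h.posDef ℓ).inv.posSemidef]

/-- The transposed V-cycle error propagation matrix contracts the norm given by `A⁻¹`. -/
theorem quadForm_inv_transpose_vcycleMat_le (h : IsMultigrid A M I c) (hc : 0 < c) {μ : ℕ}
    (hμ : 0 < μ) (ℓ : ℕ) (p : Fin (n ℓ) → ℝ) :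
    quadForm (A ℓ)⁻¹ ((vcycleMat A M I μ ℓ)ᵀ *ᵥ p) ≤
      (c / (c + 2 * μ)) ^ 2 * quadForm (A ℓ)⁻¹ p := by
  have hY := h.posSemidef_vcycleMat_mul_inv μ ℓ
  set X := vcycleMat A M I μ ℓ with hX
  set ρ := c / (c + 2 * μ) with hρ
  have hρ0 : 0 ≤ ρ := by positivity
  set q := Xᵀ *ᵥ p with hq
  have e : p ⬝ᵥ (X * (A ℓ)⁻¹) *ᵥ q = quadForm (A ℓ)⁻¹ q := by
    rw [quadForm, ← mulVec_mulVec, dotProduct_mulVec, ← mulVec_transpose]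
  -- Cauchy–Schwarz for `X A⁻¹` gives `A⁻¹[q] ^ 2 ≤ (ρ A⁻¹[p]) (ρ A⁻¹[q])`; one factor `A⁻¹[q]` is
  -- then cancelled.
  have h1 := sq_dotProduct_mulVec_le hY p q
  rw [e] at h1
  have h2 := h.quadForm_vcycleMat_mul_inv_le hc hμ ℓ p
  have h3 := h.quadForm_vcycleMat_mul_inv_le hc hμ ℓ q
  have h4 := quadForm_nonneg (h.posDef ℓ).inv.posSemidef q
  have h5 := quadForm_nonneg (h.posDef ℓ).inv.posSemidef p
  have h6 := mul_le_mul h2 h3 (quadForm_nonneg hY q) (by positivity)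
  rcases h4.eq_or_lt with h0 | h0
  · rw [← h0]; positivity
  · refine le_of_mul_le_mul_right ?_ h0
    nlinarith

end IsMultigrid

open MeasureTheory ProbabilityTheory

/-! ### Affine structure of the update -/

theorem toEuclideanLin_mul_apply {k l r : ℕ} (B : Matrix (Fin k) (Fin l) ℝ)
    (D : Matrix (Fin l) (Fin r) ℝ) (x : Vec r) :
    toEuclideanLin (B * D) x = toEuclideanLin B (toEuclideanLin D x) := by
  simp

theorem toEuclideanLin_one_apply {k : ℕ} (x : Vec k) :
    toEuclideanLin (1 : Mat k) x = x := by
  simp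

theorem inner_toEuclideanLin {k l : ℕ} (B : Matrix (Fin k) (Fin l) ℝ) (p : Vec k) (x : Vec l) :
    inner ℝ p (toEuclideanLin B x) = inner ℝ (toEuclideanLin Bᵀ p) x := by
  simp only [EuclideanSpace.inner_eq_star_dotProduct, star_trivial, toLpLin_apply,
    mulVec_transpose]
  rw [dotProduct_comm, dotProduct_mulVec, dotProduct_comm]

theorem inner_toEuclideanLin_self {k : ℕ} (W : Mat k) (p : Vec k) :
    inner ℝ p (toEuclideanLin W p) = quadForm W p.ofLp := by
  simp only [EuclideanSpace.inner_eq_star_dotProduct, star_trivial, toLpLin_apply, quadForm]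
  rw [dotProduct_comm]

theorem randomSmoother_sub {k : ℕ} {A M : Mat k} (hA : A.PosDef) (f ξ θ : Vec k) :
    randomSmoother A M f ξ θ - toEuclideanLin A⁻¹ f =
      toEuclideanLin (smootherMat A M) (θ - toEuclideanLin A⁻¹ f) + toEuclideanLin M⁻¹ ξ := by
  have h : f = toEuclideanLin A (toEuclideanLin A⁻¹ f) := by
    rw [← toEuclideanLin_mul_apply, mul_inv_of_posDef hA, toEuclideanLin_one_apply]
  generalize toEuclideanLin A⁻¹ f = g at h
  subst h
  simp only [randomSmoother, smootherMat, map_sub, map_add, LinearMap.sub_apply,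
    toEuclideanLin_one_apply, toEuclideanLin_mul_apply]
  abel

theorem smooth_zero_succ {k : ℕ} {A M : Mat k} (hA : A.PosDef) (ξ : ℕ → Vec k) (ν : ℕ) :
    smooth A M 0 ξ 0 (ν + 1) = toEuclideanLin (smootherMat A M) (smooth A M 0 ξ 0 ν) +
      toEuclideanLin M⁻¹ (ξ ν) := by
  rw [smooth]
  simpa using randomSmoother_sub (M := M) hA 0 (ξ ν) (smooth A M 0 ξ 0 ν)

/-- By affinity the accumulated noise is the smoother itself run from `0` with right-hand side `0`,
so it needs no separate formula. -/
theorem smooth_sub {k : ℕ} {A M : Mat k} (hA : A.PosDef) (f : Vec k) (ξ : ℕ → Vec k)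
    (θ : Vec k) (ν : ℕ) :
    smooth A M f ξ θ ν - toEuclideanLin A⁻¹ f =
      toEuclideanLin (smootherMat A M ^ ν) (θ - toEuclideanLin A⁻¹ f) +
        smooth A M 0 ξ 0 ν := by
  induction ν with
  | zero => simp [smooth]
  | succ ν ih =>
    rw [smooth_zero_succ hA, smooth, randomSmoother_sub hA, ih, pow_succ', toEuclideanLin_mul_apply,
      map_add, add_assoc]

section Mgmc

variable {n : ℕ → ℕ} {A M : ∀ ℓ, Mat (n ℓ)}
  {I : ∀ ℓ, Matrix (Fin (n (ℓ + 1))) (Fin (n ℓ)) ℝ} {c : ℝ}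

/-- The inductive step of `mgmc_sub` with the noise written out. Taking `f = θ = 0` identifies this
noise with `mgmc` run from zero data, whose second moment is then computed from the explicit form.
-/
theorem mgmc_succ_sub (h : IsMultigrid A M I c) (μ ℓ : ℕ) (ξ : (i : Draw) → Vec (n i.level))
    (hℓ : ∀ f θ, mgmc A M M I μ μ ξ ℓ f θ - toEuclideanLin (A ℓ)⁻¹ f =
      toEuclideanLin (vcycleMat A M I μ ℓ) (θ - toEuclideanLin (A ℓ)⁻¹ f) +
        mgmc A M M I μ μ ξ ℓ 0 0) (f θ : Vec (n (ℓ + 1))) :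
    mgmc A M M I μ μ ξ (ℓ + 1) f θ - toEuclideanLin (A (ℓ + 1))⁻¹ f =
      toEuclideanLin (vcycleMat A M I μ (ℓ + 1)) (θ - toEuclideanLin (A (ℓ + 1))⁻¹ f) +
      (toEuclideanLin (smootherMat (A (ℓ + 1)) (M (ℓ + 1)) ^ μ)
        (toEuclideanLin (coarseMat A I ℓ (vcycleMat A M I μ ℓ))
            (smooth (A (ℓ + 1)) (M (ℓ + 1)) 0 (fun j => ξ (.pre (ℓ + 1) j)) 0 μ) +
          toEuclideanLin (I ℓ) (mgmc A M M I μ μ ξ ℓ 0 0)) +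
        smooth (A (ℓ + 1)) (M (ℓ + 1)) 0 (fun j => ξ (.post (ℓ + 1) j)) 0 μ) := by
  have hA := h.posDef (ℓ + 1)
  rw [mgmc, smooth_sub hA]
  set θ₁ := smooth (A (ℓ + 1)) (M (ℓ + 1)) f (fun j => ξ (.pre (ℓ + 1) j)) θ μ with hθ₁
  have h1 : θ₁ - toEuclideanLin (A (ℓ + 1))⁻¹ f = _ := smooth_sub hA _ _ _ _
  have h2 : f - toEuclideanLin (A (ℓ + 1)) θ₁ =
      - toEuclideanLin (A (ℓ + 1)) (θ₁ - toEuclideanLin (A (ℓ + 1))⁻¹ f) := by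
    rw [map_sub, ← toEuclideanLin_mul_apply, mul_inv_of_posDef hA, toEuclideanLin_one_apply]
    abel
  set e := θ₁ - toEuclideanLin (A (ℓ + 1))⁻¹ f with he
  set f' := toEuclideanLin (I ℓ)ᵀ (f - toEuclideanLin (A (ℓ + 1)) θ₁) with hf'
  have h3 := sub_eq_iff_eq_add.1 (hℓ f' 0)
  -- The coarse solve starts at `0`, so its initial error is `-A_ℓ⁻¹ f'` and it returns `(1 - X_ℓ)
  -- A_ℓ⁻¹ f'` plus noise, where `f' = -Iᵀ A e`.
  have h4 : θ₁ + toEuclideanLin (I ℓ) (mgmc A M M I μ μ ξ ℓ f' 0) -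
      toEuclideanLin (A (ℓ + 1))⁻¹ f =
      toEuclideanLin (coarseMat A I ℓ (vcycleMat A M I μ ℓ)) e +
        toEuclideanLin (I ℓ) (mgmc A M M I μ μ ξ ℓ 0 0) := by
    rw [h3, add_sub_right_comm, ← he, hf', h2]
    simp only [coarseMat, map_sub, map_add, map_neg, LinearMap.sub_apply, zero_sub, neg_neg,
      toEuclideanLin_one_apply, toEuclideanLin_mul_apply]
    abel
  rw [h4, h1, vcycleMat]
  simp only [map_add, toEuclideanLin_mul_apply]
  abel

/-- The error of the new state is the propagated error of the old state plus a noise term that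
depends only on the draws. -/
theorem mgmc_sub (h : IsMultigrid A M I c) (μ ℓ : ℕ) (ξ : (i : Draw) → Vec (n i.level))
    (f θ : Vec (n ℓ)) :
    mgmc A M M I μ μ ξ ℓ f θ - toEuclideanLin (A ℓ)⁻¹ f =
      toEuclideanLin (vcycleMat A M I μ ℓ) (θ - toEuclideanLin (A ℓ)⁻¹ f) +
        mgmc A M M I μ μ ξ ℓ 0 0 := by
  induction ℓ with
  | zero => simp [mgmc, vcycleMat]
  | succ ℓ ih =>
    have h0 := mgmc_succ_sub h μ ℓ ξ ih 0 0
    simp only [map_zero, sub_zero, zero_add] at h0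
    rw [mgmc_succ_sub h μ ℓ ξ ih, ← h0]

theorem mgmc_zero_succ (h : IsMultigrid A M I c) (μ ℓ : ℕ) (ξ : (i : Draw) → Vec (n i.level)) :
    mgmc A M M I μ μ ξ (ℓ + 1) 0 0 =
      toEuclideanLin (smootherMat (A (ℓ + 1)) (M (ℓ + 1)) ^ μ)
        (toEuclideanLin (coarseMat A I ℓ (vcycleMat A M I μ ℓ))
            (smooth (A (ℓ + 1)) (M (ℓ + 1)) 0 (fun j => ξ (.pre (ℓ + 1) j)) 0 μ) +
          toEuclideanLin (I ℓ) (mgmc A M M I μ μ ξ ℓ 0 0)) +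
        smooth (A (ℓ + 1)) (M (ℓ + 1)) 0 (fun j => ξ (.post (ℓ + 1) j)) 0 μ := by
  simpa using mgmc_succ_sub h μ ℓ ξ (fun f θ => mgmc_sub h μ ℓ ξ f θ) 0 0

theorem Draw.Used.succ {ℓ ν₁ ν₂ : ℕ} {i : Draw} (h : i.Used ℓ ν₁ ν₂) :
    i.Used (ℓ + 1) ν₁ ν₂ := by
  cases i with
  | coarse => trivial
  | pre l j => exact ⟨h.1, h.2.1.trans ℓ.le_succ, h.2.2⟩
  | post l j => exact ⟨h.1, h.2.1.trans ℓ.le_succ, h.2.2⟩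

theorem Draw.Used.ne_pre {ℓ ν₁ ν₂ j : ℕ} {i : Draw} (h : i.Used ℓ ν₁ ν₂) :
    i ≠ .pre (ℓ + 1) j := by
  rintro rfl
  exact absurd h.2.1 (by omega)

theorem Draw.Used.ne_post {ℓ ν₁ ν₂ j : ℕ} {i : Draw} (h : i.Used ℓ ν₁ ν₂) :
    i ≠ .post (ℓ + 1) j := by
  rintro rfl
  exact absurd h.2.1 (by omega)

end Mgmc

/-! ### Spaces of random variables -/

/-- All linear functionals of the random vector `Y` belong to the space `𝒮` of random variables. -/
def CoordMem {Ω : Type*} (𝒮 : Submodule ℝ (Ω → ℝ)) {k : ℕ} (Y : Ω → Vec k) : Prop :=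
  ∀ p : Vec k, (fun ω => inner ℝ p (Y ω)) ∈ 𝒮

namespace CoordMem

variable {Ω : Type*} {𝒮 : Submodule ℝ (Ω → ℝ)}

theorem zero {k : ℕ} : CoordMem 𝒮 (fun _ => (0 : Vec k)) := fun p => by
  simpa using (show (fun _ : Ω => (0 : ℝ)) ∈ 𝒮 from 𝒮.zero_mem)

theorem add {k : ℕ} {Y Z : Ω → Vec k} (hY : CoordMem 𝒮 Y) (hZ : CoordMem 𝒮 Z) :
    CoordMem 𝒮 (fun ω => Y ω + Z ω) := fun p => by
  simp only [inner_add_right]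
  exact 𝒮.add_mem (hY p) (hZ p)

theorem sub {k : ℕ} {Y Z : Ω → Vec k} (hY : CoordMem 𝒮 Y) (hZ : CoordMem 𝒮 Z) :
    CoordMem 𝒮 (fun ω => Y ω - Z ω) := fun p => by
  simp only [inner_sub_right]
  exact 𝒮.sub_mem (hY p) (hZ p)

theorem toEuclideanLin {k l : ℕ} {Y : Ω → Vec l} (hY : CoordMem 𝒮 Y)
    (B : Matrix (Fin k) (Fin l) ℝ) : CoordMem 𝒮 (fun ω => Matrix.toEuclideanLin B (Y ω)) :=
  fun p => by
    simp only [inner_toEuclideanLin]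
    exact hY _

theorem smooth {k : ℕ} {A M : Mat k} {f θ : Ω → Vec k} {ξ : ℕ → Ω → Vec k} {ν : ℕ}
    (hf : CoordMem 𝒮 f) (hξ : ∀ j < ν, CoordMem 𝒮 (ξ j)) (hθ : CoordMem 𝒮 θ) :
    CoordMem 𝒮 (fun ω => MGMC.smooth A M (f ω) (fun j => ξ j ω) (θ ω) ν) := by
  induction ν with
  | zero => exact hθ
  | succ ν ih =>
    have h := ih fun j hj => hξ j (hj.trans ν.lt_succ_self)
    exact h.add (((hf.add (hξ ν ν.lt_succ_self)).sub (h.toEuclideanLin A)).toEuclideanLin M⁻¹)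

/-- The output is linear in draws, right-hand side and state jointly, so it stays in any subspace
containing their functionals. With `squareIntegrable` this yields finite moments, with
`orthogonalTo` it propagates uncorrelatedness. -/
theorem mgmc {n : ℕ → ℕ} {A M₁ M₂ : ∀ ℓ, Mat (n ℓ)}
    {I : ∀ ℓ, Matrix (Fin (n (ℓ + 1))) (Fin (n ℓ)) ℝ} {ν₁ ν₂ : ℕ}
    {ξ : (i : Draw) → Ω → Vec (n i.level)} (ℓ : ℕ)
    (hξ : ∀ i : Draw, i.Used ℓ ν₁ ν₂ → CoordMem 𝒮 (ξ i)) {f θ : Ω → Vec (n ℓ)}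
    (hf : CoordMem 𝒮 f) (hθ : CoordMem 𝒮 θ) :
    CoordMem 𝒮 (fun ω => MGMC.mgmc A M₁ M₂ I ν₁ ν₂ (fun i => ξ i ω) ℓ (f ω) (θ ω)) := by
  induction ℓ with
  | zero => exact (hf.toEuclideanLin _).add (hξ .coarse trivial)
  | succ ℓ ih =>
    have h1 := CoordMem.smooth (A := A (ℓ + 1)) (M := M₁ (ℓ + 1)) hf
      (fun j hj => hξ (.pre (ℓ + 1) j) ⟨by omega, le_rfl, hj⟩) hθ
    have h2 := ih (fun i hi => hξ i hi.succ)
      ((hf.sub (h1.toEuclideanLin (A (ℓ + 1)))).toEuclideanLin (I ℓ)ᵀ) zero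
    exact hf.smooth (fun j hj => hξ (.post (ℓ + 1) j) ⟨by omega, le_rfl, hj⟩)
      (h1.add (h2.toEuclideanLin (I ℓ)))

theorem sum_mem {k : ℕ} {e : ℕ → Ω → Vec k} {M : ℕ}
    (hM : ∀ m ≤ M, CoordMem 𝒮 (e m)) (F : Vec k) :
    (fun ω => ∑ m ∈ Finset.Icc 1 M, inner ℝ F (e m ω)) ∈ 𝒮 := by
  have := 𝒮.sum_mem (t := Finset.Icc 1 M) (f := fun m ω => inner ℝ F (e m ω))
    fun m hm => hM m (Finset.mem_Icc.1 hm).2 F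
  convert this using 1
  funext ω
  simp

end CoordMem

/-- The space of square integrable random variables. -/
def squareIntegrable {Ω : Type*} [MeasurableSpace Ω] (P : Measure Ω) : Submodule ℝ (Ω → ℝ) where
  carrier := {u | MemLp u 2 P}
  add_mem' hu hv := hu.add hv
  zero_mem' := MemLp.zero
  smul_mem' c _ hu := hu.const_smul c

/-- The square integrable random variables that are orthogonal to `v`. -/
def orthogonalTo {Ω : Type*} [MeasurableSpace Ω] {P : Measure Ω} {v : Ω → ℝ} (hv : MemLp v 2 P) :
    Submodule ℝ (Ω → ℝ) where
  carrier := {u | MemLp u 2 P ∧ ∫ ω, v ω * u ω ∂P = 0}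
  add_mem' := by
    rintro u w ⟨hu, hu0⟩ ⟨hw, hw0⟩
    refine ⟨hu.add hw, ?_⟩
    -- Additivity of the integral needs integrable products, which is why the carrier also demands
    -- `MemLp`.
    have h := integral_add (hv.integrable_mul hu) (hv.integrable_mul hw)
    simp only [Pi.mul_apply, hu0, hw0, add_zero] at h
    simpa only [Pi.add_apply, mul_add] using h
  zero_mem' := ⟨MemLp.zero, by simp⟩
  smul_mem' := by
    rintro c u ⟨hu, hu0⟩
    refine ⟨hu.const_smul c, ?_⟩
    simp only [Pi.smul_apply, smul_eq_mul, mul_left_comm _ c]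
    rw [integral_const_mul, hu0, mul_zero]

/-- The random vectors `Y` and `Z` are uncorrelated (without centering). -/
def Orthogonal {Ω : Type*} [MeasurableSpace Ω] (P : Measure Ω) {k l : ℕ} (Y : Ω → Vec k)
    (Z : Ω → Vec l) : Prop :=
  ∀ p q, ∫ ω, inner ℝ p (Y ω) * inner ℝ q (Z ω) ∂P = 0

/-- `W` is the (not centered) second moment matrix of `Y`. -/
def SecondMoment {Ω : Type*} [MeasurableSpace Ω] (P : Measure Ω) {k : ℕ} (Y : Ω → Vec k)
    (W : Mat k) : Prop :=
  ∀ p : Vec k, ∫ ω, inner ℝ p (Y ω) ^ 2 ∂P = quadForm W p.ofLp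

section SecondMoment

variable {Ω : Type*} [MeasurableSpace Ω] {P : Measure Ω}

theorem Orthogonal.symm {k l : ℕ} {Y : Ω → Vec k} {Z : Ω → Vec l} (h : Orthogonal P Y Z) :
    Orthogonal P Z Y := fun p q => by
  simp only [mul_comm (inner ℝ p _)]
  exact h q p

theorem Orthogonal.coordMem {k l : ℕ} {Y : Ω → Vec k} {Z : Ω → Vec l} (h : Orthogonal P Y Z)
    (hY : CoordMem (squareIntegrable P) Y) (hZ : CoordMem (squareIntegrable P) Z) (p : Vec k) :
    CoordMem (orthogonalTo (hY p)) Z := fun q => ⟨hZ q, h p q⟩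

theorem Orthogonal.of_coordMem {k l : ℕ} {Y : Ω → Vec k} {Z : Ω → Vec l}
    (hY : CoordMem (squareIntegrable P) Y) (h : ∀ p, CoordMem (orthogonalTo (hY p)) Z) :
    Orthogonal P Y Z := fun p q => (h p q).2

theorem SecondMoment.add {k : ℕ} {Y Z : Ω → Vec k} {W W' : Mat k} (hW : SecondMoment P Y W)
    (hW' : SecondMoment P Z W') (hY : CoordMem (squareIntegrable P) Y)
    (hZ : CoordMem (squareIntegrable P) Z) (h : Orthogonal P Y Z) :
    SecondMoment P (fun ω => Y ω + Z ω) (W + W') := fun p => by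
  have hi : Integrable (fun ω => 2 * (inner ℝ p (Y ω) * inner ℝ p (Z ω))) P :=
    (MemLp.integrable_mul (hY p) (hZ p)).const_mul 2
  have e : (fun ω => inner ℝ p (Y ω + Z ω) ^ 2) = fun ω =>
      inner ℝ p (Y ω) ^ 2 + 2 * (inner ℝ p (Y ω) * inner ℝ p (Z ω)) + inner ℝ p (Z ω) ^ 2 := by
    funext ω
    rw [inner_add_right]; ring
  rw [e, integral_add _ (MemLp.integrable_sq (hZ p)), integral_add (MemLp.integrable_sq (hY p)) hi,
    integral_const_mul, h, hW, hW', quadForm_add]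
  · ring
  · exact (MemLp.integrable_sq (hY p)).add hi

theorem SecondMoment.toEuclideanLin {k l : ℕ} {Y : Ω → Vec l} {W : Mat l}
    (hW : SecondMoment P Y W) (B : Matrix (Fin k) (Fin l) ℝ) :
    SecondMoment P (fun ω => Matrix.toEuclideanLin B (Y ω)) (B * W * Bᵀ) := fun p => by
  simp only [inner_toEuclideanLin]
  rw [hW, quadForm_conj]
  simp

theorem secondMoment_zero {k : ℕ} : SecondMoment P (fun _ => (0 : Vec k)) 0 := fun p => by
  simp [quadForm_zero]

/-- The second moment of the random smoother, started in `0` with right-hand side `0`, if the draws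
are pairwise orthogonal. -/
theorem secondMoment_smooth {k : ℕ} {A M : Mat k} (h : SmoothingProperty A M)
    {ξ : ℕ → Ω → Vec k} {ν : ℕ} (hξ : ∀ j < ν, CoordMem (squareIntegrable P) (ξ j))
    (hW : ∀ j < ν, SecondMoment P (ξ j) (M + Mᵀ - A))
    (ho : ∀ i < ν, ∀ j < ν, i ≠ j → Orthogonal P (ξ i) (ξ j)) :
    SecondMoment P (fun ω => smooth A M 0 (fun j => ξ j ω) 0 ν)
      (A⁻¹ - smootherMat A M ^ ν * A⁻¹ * (smootherMat A M ^ ν)ᵀ) := by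
  induction ν with
  | zero => simpa [smooth] using secondMoment_zero (P := P) (k := k)
  | succ ν ih =>
    have hlt : ∀ {j}, j < ν → j < ν + 1 := fun hj => hj.trans ν.lt_succ_self
    have ih := ih (fun j hj => hξ j (hlt hj)) (fun j hj => hW j (hlt hj))
      fun i hi j hj => ho i (hlt hi) j (hlt hj)
    have hν := hξ ν ν.lt_succ_self
    have hS : CoordMem (squareIntegrable P) fun ω => smooth A M 0 (fun j => ξ j ω) 0 ν :=
      CoordMem.smooth CoordMem.zero (fun j hj => hξ j (hlt hj)) CoordMem.zero
    have hO : Orthogonal P (fun ω => toEuclideanLin M⁻¹ (ξ ν ω))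
        (fun ω => toEuclideanLin (smootherMat A M) (smooth A M 0 (fun j => ξ j ω) 0 ν)) := by
      refine Orthogonal.of_coordMem (hν.toEuclideanLin _) fun p => ?_
      refine (CoordMem.smooth CoordMem.zero (fun j hj => ?_) CoordMem.zero).toEuclideanLin _
      refine fun q => ⟨hξ j (hlt hj) q, ?_⟩
      simp only [inner_toEuclideanLin]
      exact ho ν ν.lt_succ_self j (hlt hj) hj.ne' _ _
    have := (ih.toEuclideanLin (smootherMat A M)).add
      ((hW ν ν.lt_succ_self).toEuclideanLin M⁻¹) (hS.toEuclideanLin _) (hν.toEuclideanLin _)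
      hO.symm
    simp only [smooth_zero_succ h.2.1]
    convert this using 1
    -- Together `e1` and `e2` say `R A⁻¹ Rᵀ + M⁻¹ (M + Mᵀ - A) M⁻ᵀ = A⁻¹`: one smoothing step leaves
    -- the covariance `A⁻¹` invariant.
    have e1 : M⁻¹ * (M + Mᵀ - A) * (M⁻¹)ᵀ = M⁻¹ + M⁻¹ - M⁻¹ * A * M⁻¹ := by
      rw [h.isSymm_inv, h.1, Matrix.mul_sub, Matrix.mul_add, h.inv_mul, Matrix.sub_mul,
        Matrix.add_mul, Matrix.one_mul]
    have e2 : smootherMat A M * A⁻¹ * (smootherMat A M)ᵀ = A⁻¹ - (M⁻¹ + M⁻¹ - M⁻¹ * A * M⁻¹) := by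
      rw [h.smootherMat_mul_inv, h.transpose_smootherMat]
      have := inv_mul_of_posDef h.2.1
      simp only [Matrix.sub_mul, Matrix.mul_sub, Matrix.mul_one, ← Matrix.mul_assoc, this,
        Matrix.one_mul]
      abel
    rw [Matrix.mul_sub, Matrix.sub_mul, e1, e2, pow_succ', transpose_mul]
    simp only [Matrix.mul_assoc]
    abel

end SecondMoment

/-! ### The noise of one V-cycle -/

/-- The covariance matrices of the draws. -/
noncomputable def drawCov {n : ℕ → ℕ} (A M : ∀ ℓ, Mat (n ℓ)) : (i : Draw) → Mat (n i.level)
  | .coarse => (A 0)⁻¹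
  | .pre ℓ _ => M ℓ + (M ℓ)ᵀ - A ℓ
  | .post ℓ _ => M ℓ + (M ℓ)ᵀ - A ℓ

/-- The second order properties of the draws of one V-cycle. -/
structure IsDrawFamily {n : ℕ → ℕ} (A M : ∀ ℓ, Mat (n ℓ)) (μ ℓ : ℕ) {Ω : Type*}
    [MeasurableSpace Ω] (P : Measure Ω) (ξ : (i : Draw) → Ω → Vec (n i.level)) : Prop where
  coordMem : ∀ i : Draw, i.Used ℓ μ μ → CoordMem (squareIntegrable P) (ξ i)
  secondMoment : ∀ i : Draw, i.Used ℓ μ μ → SecondMoment P (ξ i) (drawCov A M i)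
  orthogonal : ∀ i j : Draw, i.Used ℓ μ μ → j.Used ℓ μ μ → i ≠ j → Orthogonal P (ξ i) (ξ j)

section Noise

variable {n : ℕ → ℕ} {A M : ∀ ℓ, Mat (n ℓ)}
  {I : ∀ ℓ, Matrix (Fin (n (ℓ + 1))) (Fin (n ℓ)) ℝ} {c : ℝ} {μ ℓ : ℕ}
  {Ω : Type*} [MeasurableSpace Ω] {P : Measure Ω} {ξ : (i : Draw) → Ω → Vec (n i.level)}

theorem IsDrawFamily.of_succ (h : IsDrawFamily A M μ (ℓ + 1) P ξ) : IsDrawFamily A M μ ℓ P ξ :=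
  ⟨fun i hi => h.coordMem i hi.succ, fun i hi => h.secondMoment i hi.succ,
    fun i j hi hj => h.orthogonal i j hi.succ hj.succ⟩

/-- The random coarse correction preserves `A⁻¹`. With the symmetric `Q = (1 - X) A_ℓ⁻¹` its matrix
is `1 - I Q Iᵀ A`, and Galerkin reduces the covariance lost to `I (2 Q - Q A_ℓ Q) Iᵀ`. This is
exactly what the coarse noise restores. -/
theorem IsMultigrid.coarseMat_conj (h : IsMultigrid A M I c) (μ ℓ : ℕ) :
    coarseMat A I ℓ (vcycleMat A M I μ ℓ) * (A (ℓ + 1))⁻¹ *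
        (coarseMat A I ℓ (vcycleMat A M I μ ℓ))ᵀ +
      I ℓ * ((A ℓ)⁻¹ - vcycleMat A M I μ ℓ * (A ℓ)⁻¹ * (vcycleMat A M I μ ℓ)ᵀ) * (I ℓ)ᵀ =
      (A (ℓ + 1))⁻¹ := by
  have h1 := mul_inv_of_posDef (h.posDef (ℓ + 1))
  have h2 := inv_mul_of_posDef (h.posDef (ℓ + 1))
  have h3 := inv_mul_of_posDef (h.posDef ℓ)
  have h4 := h.galerkin ℓ
  have h5 := isSymm_of_posSemidef (h.posDef ℓ).inv.posSemidef
  have h6 := isSymm_of_posSemidef (h.posDef (ℓ + 1)).posSemidef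
  have h7 := h.mul_conj_vcycleMat μ ℓ
  set X := vcycleMat A M I μ ℓ
  set Q := (1 - X) * (A ℓ)⁻¹ with hQ
  have hQt : Qᵀ = Q := by
    rw [hQ, transpose_mul, h5, transpose_sub, transpose_one, Matrix.mul_sub, ← h7, Matrix.sub_mul,
      Matrix.one_mul, Matrix.mul_one]
  have hK : coarseMat A I ℓ X = 1 - I ℓ * Q * (I ℓ)ᵀ * A (ℓ + 1) := by
    simp only [coarseMat, hQ, Matrix.mul_assoc]
  have hKt : (coarseMat A I ℓ X)ᵀ = 1 - A (ℓ + 1) * (I ℓ * Q * (I ℓ)ᵀ) := by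
    rw [hK, transpose_sub, transpose_one, transpose_mul, h6, transpose_mul, transpose_mul,
      transpose_transpose, hQt, Matrix.mul_assoc (I ℓ)]
  have hQQ : Q * A ℓ * Q = (1 - X) * (A ℓ)⁻¹ * (1 - X)ᵀ := by
    calc Q * A ℓ * Q = Q * A ℓ * Qᵀ := by rw [hQt]
      _ = (1 - X) * ((A ℓ)⁻¹ * A ℓ) * (A ℓ)⁻¹ * (1 - X)ᵀ := by
        rw [hQ, transpose_mul, h5]; simp only [Matrix.mul_assoc]
      _ = _ := by rw [h3, Matrix.mul_one]
  have e1 : coarseMat A I ℓ X * (A (ℓ + 1))⁻¹ * (coarseMat A I ℓ X)ᵀ =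
      (A (ℓ + 1))⁻¹ - I ℓ * (Q + Q - Q * A ℓ * Q) * (I ℓ)ᵀ := by
    rw [hKt, hK, Matrix.sub_mul, Matrix.mul_assoc _ (A (ℓ + 1)), h1, ← h4]
    simp only [Matrix.sub_mul, Matrix.mul_sub, Matrix.mul_one, Matrix.one_mul, Matrix.mul_add,
      Matrix.add_mul, ← Matrix.mul_assoc, h2]
    abel
  have e2 : Q + Q - Q * A ℓ * Q = (A ℓ)⁻¹ - X * (A ℓ)⁻¹ * Xᵀ := by
    rw [hQQ, hQ, transpose_sub, transpose_one]
    simp only [Matrix.sub_mul, Matrix.mul_sub, Matrix.mul_one, Matrix.one_mul]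
    rw [← h7]
    abel
  rw [e1, e2, sub_add_cancel]

theorem IsDrawFamily.coordMem_noise (hξ : IsDrawFamily A M μ ℓ P ξ) :
    CoordMem (squareIntegrable P) (fun ω => mgmc A M M I μ μ (fun i => ξ i ω) ℓ 0 0) :=
  CoordMem.mgmc ℓ hξ.coordMem CoordMem.zero CoordMem.zero

/-- The covariance of the noise of one V-cycle is such that `𝒩(0, A⁻¹)` is invariant. -/
theorem IsDrawFamily.secondMoment_noise (h : IsMultigrid A M I c)
    (hξ : IsDrawFamily A M μ ℓ P ξ) :
    SecondMoment P (fun ω => mgmc A M M I μ μ (fun i => ξ i ω) ℓ 0 0)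
      ((A ℓ)⁻¹ - vcycleMat A M I μ ℓ * (A ℓ)⁻¹ * (vcycleMat A M I μ ℓ)ᵀ) := by
  induction ℓ with
  | zero =>
    simp only [mgmc, vcycleMat, map_zero, zero_add, Matrix.zero_mul, sub_zero]
    exact hξ.secondMoment .coarse trivial
  | succ ℓ ih =>
    have hpre : ∀ j < μ, (Draw.pre (ℓ + 1) j).Used (ℓ + 1) μ μ := fun j hj =>
      ⟨by omega, le_rfl, hj⟩
    have hpost : ∀ j < μ, (Draw.post (ℓ + 1) j).Used (ℓ + 1) μ μ := fun j hj =>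
      ⟨by omega, le_rfl, hj⟩
    have s1 := secondMoment_smooth (P := P) (ξ := fun j => ξ (.pre (ℓ + 1) j)) (h.smoothing ℓ)
      (fun j hj => hξ.coordMem _ (hpre j hj)) (fun j hj => hξ.secondMoment _ (hpre j hj))
      (fun i hi j hj hij => hξ.orthogonal _ _ (hpre i hi) (hpre j hj) (by simpa using hij))
    have s3 := secondMoment_smooth (P := P) (ξ := fun j => ξ (.post (ℓ + 1) j)) (h.smoothing ℓ)
      (fun j hj => hξ.coordMem _ (hpost j hj)) (fun j hj => hξ.secondMoment _ (hpost j hj))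
      (fun i hi j hj hij => hξ.orthogonal _ _ (hpost i hi) (hpost j hj) (by simpa using hij))
    have s2 := ih hξ.of_succ
    -- The subspace is left open because both square integrability and orthogonality are read off
    -- from the same statement.
    have m1 {𝒮 : Submodule ℝ (Ω → ℝ)} (hp : ∀ j < μ, CoordMem 𝒮 (ξ (.pre (ℓ + 1) j))) :=
      CoordMem.smooth (A := A (ℓ + 1)) (M := M (ℓ + 1)) CoordMem.zero hp CoordMem.zero
    have m3 {𝒮 : Submodule ℝ (Ω → ℝ)} (hp : ∀ j < μ, CoordMem 𝒮 (ξ (.post (ℓ + 1) j))) :=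
      CoordMem.smooth (A := A (ℓ + 1)) (M := M (ℓ + 1)) CoordMem.zero hp CoordMem.zero
    have m2 {𝒮 : Submodule ℝ (Ω → ℝ)} (hp : ∀ i : Draw, i.Used ℓ μ μ → CoordMem 𝒮 (ξ i)) :=
      CoordMem.mgmc (A := A) (M₁ := M) (M₂ := M) (I := I) ℓ hp CoordMem.zero CoordMem.zero
    have l1 := m1 fun j hj => hξ.coordMem _ (hpre j hj)
    have l2 := m2 fun i hi => hξ.coordMem _ hi.succ
    have l3 := m3 fun j hj => hξ.coordMem _ (hpost j hj)
    have o12 : Orthogonal P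
        (fun ω => toEuclideanLin (coarseMat A I ℓ (vcycleMat A M I μ ℓ))
          (smooth (A (ℓ + 1)) (M (ℓ + 1)) 0 (fun j => ξ (.pre (ℓ + 1) j) ω) 0 μ))
        (fun ω => toEuclideanLin (I ℓ) (mgmc A M M I μ μ (fun i => ξ i ω) ℓ 0 0)) := by
      -- Linearity is used in one slot at a time: with the left vector fixed, the right one reduces
      -- to single coarser draws; with such a draw fixed, the left one reduces to single
      -- pre-smoothing draws.
      refine Orthogonal.of_coordMem (l1.toEuclideanLin _) fun p => (m2 fun i hi q => ?_).toEuclideanLin _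
      refine (Orthogonal.symm (Orthogonal.of_coordMem (hξ.coordMem i hi.succ) fun q =>
        (m1 fun j hj => ?_).toEuclideanLin _)).coordMem (l1.toEuclideanLin _)
          (hξ.coordMem i hi.succ) p q
      exact (hξ.orthogonal _ _ hi.succ (hpre j hj) hi.ne_pre).coordMem _
        (hξ.coordMem _ (hpre j hj)) q
    have l12 := (l1.toEuclideanLin (coarseMat A I ℓ (vcycleMat A M I μ ℓ))).add
      (l2.toEuclideanLin (I ℓ))
    have l4 := l12.toEuclideanLin (smootherMat (A (ℓ + 1)) (M (ℓ + 1)) ^ μ)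
    have o3 : Orthogonal P _ _ := Orthogonal.of_coordMem l4 fun p => m3 fun j hj q =>
      (Orthogonal.symm (Orthogonal.of_coordMem (hξ.coordMem _ (hpost j hj)) fun q =>
        (((m1 fun i hi => (hξ.orthogonal _ _ (hpost j hj) (hpre i hi) (by simp)).coordMem _
            (hξ.coordMem _ (hpre i hi)) q).toEuclideanLin _).add
          ((m2 fun i hi => (hξ.orthogonal _ _ (hpost j hj) hi.succ hi.ne_post.symm).coordMem _
            (hξ.coordMem _ hi.succ) q).toEuclideanLin _)).toEuclideanLin _)).coordMem l4
          (hξ.coordMem _ (hpost j hj)) p q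
    have key := (((s1.toEuclideanLin (coarseMat A I ℓ (vcycleMat A M I μ ℓ))).add
      (s2.toEuclideanLin (I ℓ)) (l1.toEuclideanLin _) (l2.toEuclideanLin _) o12).toEuclideanLin
      (smootherMat (A (ℓ + 1)) (M (ℓ + 1)) ^ μ)).add s3 l4 l3 o3
    simp only [mgmc_zero_succ h]
    convert key using 1
    -- By `coarseMat_conj` the noise after the coarse correction has moment `A⁻¹ - K R^μ A⁻¹ (K
    -- R^μ)ᵀ`, with `K` the coarse matrix. Post-smoothing conjugates this by `R^μ` and adds `A⁻¹ -
    -- R^μ A⁻¹ (R^μ)ᵀ`, and the middle terms cancel.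
    rw [Matrix.mul_sub (coarseMat A I ℓ _), Matrix.sub_mul _ _ (coarseMat A I ℓ _)ᵀ, sub_add_eq_add_sub,
      h.coarseMat_conj, Matrix.mul_sub, Matrix.sub_mul, vcycleMat]
    simp only [transpose_mul, Matrix.mul_assoc]
    abel

end Noise

/-! ### Autoregressive processes -/

section Autoregressive

variable {Ω : Type*} [MeasurableSpace Ω] {P : Measure Ω}

/-- The Cauchy–Schwarz inequality for square integrable random variables. -/
theorem abs_integral_mul_le {u v : Ω → ℝ} (hu : MemLp u 2 P) (hv : MemLp v 2 P) :
    |∫ ω, u ω * v ω ∂P| ≤ √(∫ ω, u ω ^ 2 ∂P) * √(∫ ω, v ω ^ 2 ∂P) := by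
  have huv : Integrable (fun ω => u ω * v ω) P := hu.integrable_mul hv
  have h : ∀ t : ℝ, 0 ≤ (∫ ω, v ω ^ 2 ∂P) * (t * t) + 2 * (∫ ω, u ω * v ω ∂P) * t +
      ∫ ω, u ω ^ 2 ∂P := by
    intro t
    have e : ∫ ω, (u ω + t * v ω) ^ 2 ∂P = (∫ ω, v ω ^ 2 ∂P) * (t * t) +
        2 * (∫ ω, u ω * v ω ∂P) * t + ∫ ω, u ω ^ 2 ∂P := by
      have e' : (fun ω => (u ω + t * v ω) ^ 2) = fun ω =>
          (t * t) * v ω ^ 2 + (2 * t) * (u ω * v ω) + u ω ^ 2 := by funext ω; ring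
      rw [e', integral_add _ hu.integrable_sq,
        integral_add (hv.integrable_sq.const_mul _) (huv.const_mul _), integral_const_mul,
        integral_const_mul]
      · ring
      · exact (hv.integrable_sq.const_mul _).add (huv.const_mul _)
    rw [← e]
    exact integral_nonneg fun ω => sq_nonneg _
  have hd := discrim_le_zero h
  rw [discrim] at hd
  rw [← Real.sqrt_mul (integral_nonneg fun ω => sq_nonneg _)]
  refine Real.abs_le_sqrt ?_
  nlinarith

/-- A linear autoregressive process `e (m + 1) = X e m + w m` whose noise is uncorrelated and whose
invariant covariance `K` is contracted by `X` with rate `ρ`. -/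
structure IsAutoregressive (P : Measure Ω) {k : ℕ} (X K : Mat k) (ρ d : ℝ)
    (e w : ℕ → Ω → Vec k) : Prop where
  posSemidef : K.PosSemidef
  rate_nonneg : 0 ≤ ρ
  rate_lt_one : ρ < 1
  contraction : ∀ p, quadForm K (Xᵀ *ᵥ p) ≤ ρ ^ 2 * quadForm K p
  step : ∀ m ω, e (m + 1) ω = toEuclideanLin X (e m ω) + w m ω
  coordMem_init : CoordMem (squareIntegrable P) (e 0)
  coordMem_noise : ∀ m, CoordMem (squareIntegrable P) (w m)
  orthogonal_init : ∀ m, Orthogonal P (w m) (e 0)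
  orthogonal_noise : ∀ m j, m ≠ j → Orthogonal P (w m) (w j)
  secondMoment_noise : ∀ m, SecondMoment P (w m) (K - X * K * Xᵀ)
  one_le : 1 ≤ d
  init_le : ∀ p : Vec k, ∫ ω, inner ℝ p (e 0 ω) ^ 2 ∂P ≤ d * quadForm K p.ofLp

namespace IsAutoregressive

variable {k : ℕ} {X K : Mat k} {ρ d : ℝ} {e w : ℕ → Ω → Vec k}

theorem coordMem (h : IsAutoregressive P X K ρ d e w) (m : ℕ) :
    CoordMem (squareIntegrable P) (e m) := by
  induction m with
  | zero => exact h.coordMem_init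
  | succ m ih =>
    rw [show e (m + 1) = _ from funext (h.step m)]
    exact (ih.toEuclideanLin X).add (h.coordMem_noise m)

/-- The state `e j` involves only `e 0` and `w 0, …, w (j-1)`; the noise `w m` first enters in `e
(m+1)`, so `j = m` is still allowed. -/
theorem orthogonal (h : IsAutoregressive P X K ρ d e w) {j m : ℕ} (hjm : j ≤ m) :
    Orthogonal P (w m) (e j) := by
  refine Orthogonal.of_coordMem (h.coordMem_noise m) fun p => ?_
  induction j with
  | zero => exact (h.orthogonal_init m).coordMem _ h.coordMem_init p
  | succ j ih =>
    rw [show e (j + 1) = _ from funext (h.step j)]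
    exact ((ih (by omega)).toEuclideanLin X).add
      ((h.orthogonal_noise m j (by omega)).coordMem _ (h.coordMem_noise j) p)

theorem inner_step (h : IsAutoregressive P X K ρ d e w) (m : ℕ) (q : Vec k) (ω : Ω) :
    inner ℝ q (e (m + 1) ω) = inner ℝ (toEuclideanLin Xᵀ q) (e m ω) + inner ℝ q (w m ω) := by
  rw [h.step, inner_add_right, inner_toEuclideanLin]

/-- The bound `d K` is preserved by a step: `d X K Xᵀ + (K - X K Xᵀ) ≤ d K`, because `X K Xᵀ ≤ K`
and `d ≥ 1`. -/
theorem integral_sq_le (h : IsAutoregressive P X K ρ d e w) (m : ℕ) (p : Vec k) :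
    ∫ ω, inner ℝ p (e m ω) ^ 2 ∂P ≤ d * quadForm K p.ofLp := by
  induction m generalizing p with
  | zero => exact h.init_le p
  | succ m ih =>
    have hi := ih (toEuclideanLin Xᵀ p)
    have hw := h.secondMoment_noise m p
    rw [quadForm_sub, quadForm_conj] at hw
    have hu := h.coordMem m (toEuclideanLin Xᵀ p)
    have hv := h.coordMem_noise m p
    have huv : Integrable (fun ω =>
        2 * (inner ℝ p (w m ω) * inner ℝ (toEuclideanLin Xᵀ p) (e m ω))) P :=
      (MemLp.integrable_mul hv hu).const_mul 2
    have he : (fun ω => inner ℝ p (e (m + 1) ω) ^ 2) = fun ω =>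
        inner ℝ (toEuclideanLin Xᵀ p) (e m ω) ^ 2 +
          2 * (inner ℝ p (w m ω) * inner ℝ (toEuclideanLin Xᵀ p) (e m ω)) +
          inner ℝ p (w m ω) ^ 2 := by
      funext ω
      rw [h.inner_step]; ring
    have hadd := (MemLp.integrable_sq hu).add huv
    rw [he, integral_add (by exact hadd) (MemLp.integrable_sq hv),
      integral_add (MemLp.integrable_sq hu) huv, integral_const_mul, h.orthogonal le_rfl, hw]
    have hX : (toEuclideanLin Xᵀ p).ofLp = Xᵀ *ᵥ p.ofLp := by simp
    rw [hX] at hi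
    have h1 := h.contraction p.ofLp
    have h2 := quadForm_nonneg h.posSemidef p.ofLp
    have h3 : quadForm K (Xᵀ *ᵥ p.ofLp) ≤ quadForm K p.ofLp :=
      h1.trans (mul_le_of_le_one_left h2 (pow_le_one₀ h.rate_nonneg h.rate_lt_one.le))
    nlinarith [h.one_le]

/-- This sums the geometric series of autocovariances without computing any of them. Against the
past, `e (M+1)` acts as `X e M`, which replaces `q` by `Xᵀ q` and gains a factor `ρ`; hence the
induction over all `q`. Only the newest term adds to the bound. -/
theorem abs_integral_sum_mul_le (h : IsAutoregressive P X K ρ d e w) (F : Vec k) (M : ℕ)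
    (q : Vec k) :
    |∫ ω, (∑ m ∈ Finset.Icc 1 M, inner ℝ F (e m ω)) * inner ℝ q (e M ω) ∂P| ≤
      d * √(quadForm K F.ofLp) * √(quadForm K q.ofLp) / (1 - ρ) := by
  have hρ : 0 < 1 - ρ := sub_pos.2 h.rate_lt_one
  have hd := h.one_le
  induction M generalizing q with
  | zero =>
    simp only [Finset.Icc_eq_empty_of_lt zero_lt_one, Finset.sum_empty, zero_mul, integral_zero,
      abs_zero]
    positivity
  | succ M ih =>
    have hS := CoordMem.sum_mem (M := M) (fun m _ => h.coordMem m) F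
    have hu := h.coordMem M (toEuclideanLin Xᵀ q)
    have hv := h.coordMem_noise M q
    have hz := h.coordMem (M + 1)
    have h0 : ∫ ω, inner ℝ q (w M ω) * ∑ m ∈ Finset.Icc 1 M, inner ℝ F (e m ω) ∂P = 0 :=
      (CoordMem.sum_mem (M := M) (fun m hm => (h.orthogonal hm).coordMem (h.coordMem_noise M)
        (h.coordMem m) q) F).2
    have e1 : (fun ω => (∑ m ∈ Finset.Icc 1 (M + 1), inner ℝ F (e m ω)) *
        inner ℝ q (e (M + 1) ω)) = fun ω =>
        (∑ m ∈ Finset.Icc 1 M, inner ℝ F (e m ω)) * inner ℝ (toEuclideanLin Xᵀ q) (e M ω) +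
        inner ℝ q (w M ω) * ∑ m ∈ Finset.Icc 1 M, inner ℝ F (e m ω) +
        inner ℝ F (e (M + 1) ω) * inner ℝ q (e (M + 1) ω) := by
      funext ω
      rw [Finset.sum_Icc_succ_top (by omega), add_mul, h.inner_step M q]
      ring
    have i1 : Integrable (fun ω => (∑ m ∈ Finset.Icc 1 M, inner ℝ F (e m ω)) *
        inner ℝ (toEuclideanLin Xᵀ q) (e M ω)) P := MemLp.integrable_mul hS hu
    have i2 : Integrable (fun ω => inner ℝ q (w M ω) *
        ∑ m ∈ Finset.Icc 1 M, inner ℝ F (e m ω)) P := MemLp.integrable_mul hv hS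
    have i3 : Integrable (fun ω => inner ℝ F (e (M + 1) ω) * inner ℝ q (e (M + 1) ω)) P :=
      MemLp.integrable_mul (hz F) (hz q)
    have i12 := i1.add i2
    rw [e1, integral_add (by exact i12) i3, integral_add i1 i2, h0, add_zero]
    have b1 := ih (toEuclideanLin Xᵀ q)
    have b2 : √(quadForm K (toEuclideanLin Xᵀ q).ofLp) ≤ ρ * √(quadForm K q.ofLp) := by
      rw [Real.sqrt_le_left (mul_nonneg h.rate_nonneg (Real.sqrt_nonneg _)), mul_pow,
        Real.sq_sqrt (quadForm_nonneg h.posSemidef _)]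
      simpa using h.contraction q.ofLp
    have b3 := abs_integral_mul_le (hz F) (hz q)
    have b4 := Real.sqrt_le_sqrt (h.integral_sq_le (M + 1) F)
    have b5 := Real.sqrt_le_sqrt (h.integral_sq_le (M + 1) q)
    rw [Real.sqrt_mul (by linarith)] at b4 b5
    have b6 := mul_le_mul b4 b5 (Real.sqrt_nonneg _) (by positivity)
    have b7 := Real.mul_self_sqrt (show 0 ≤ d by linarith)
    have b8 : d * √(quadForm K F.ofLp) * √(quadForm K (toEuclideanLin Xᵀ q).ofLp) / (1 - ρ) ≤
        d * √(quadForm K F.ofLp) * (ρ * √(quadForm K q.ofLp)) / (1 - ρ) := by gcongr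
    -- The constant is the fixed point of `B = ρ B + d √K[F] √K[q]`.
    have b9 : d * √(quadForm K F.ofLp) * √(quadForm K q.ofLp) / (1 - ρ) =
        d * √(quadForm K F.ofLp) * (ρ * √(quadForm K q.ofLp)) / (1 - ρ) +
        √d * √(quadForm K F.ofLp) * (√d * √(quadForm K q.ofLp)) := by
      rw [show √d * √(quadForm K F.ofLp) * (√d * √(quadForm K q.ofLp)) =
        √d * √d * √(quadForm K F.ofLp) * √(quadForm K q.ofLp) by ring, b7]
      field_simp
      ring
    rw [b9]
    exact (abs_add_le _ _).trans (add_le_add (b1.trans b8) (b3.trans b6))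

/-- The second moment of the partial sums of a functional grows at most linearly. -/
theorem integral_sum_sq_le (h : IsAutoregressive P X K ρ d e w) (F : Vec k) (M : ℕ) :
    ∫ ω, (∑ m ∈ Finset.Icc 1 M, inner ℝ F (e m ω)) ^ 2 ∂P ≤
      M * (2 * (d * quadForm K F.ofLp / (1 - ρ))) := by
  induction M with
  | zero => simp
  | succ M ih =>
    have hS := CoordMem.sum_mem (M := M) (fun m _ => h.coordMem m) F
    have hS' := CoordMem.sum_mem (M := M + 1) (fun m _ => h.coordMem m) F
    have hz := h.coordMem (M + 1) F
    -- The new sum, not the old one, multiplies the new term, so the previous lemma applies with `q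
    -- = F` and the remaining square has a favourable sign.
    have e1 : (fun ω => (∑ m ∈ Finset.Icc 1 (M + 1), inner ℝ F (e m ω)) ^ 2) = fun ω =>
        (∑ m ∈ Finset.Icc 1 M, inner ℝ F (e m ω)) ^ 2 +
        2 * ((∑ m ∈ Finset.Icc 1 (M + 1), inner ℝ F (e m ω)) * inner ℝ F (e (M + 1) ω)) -
        inner ℝ F (e (M + 1) ω) ^ 2 := by
      funext ω
      rw [Finset.sum_Icc_succ_top (by omega)]
      ring
    have i1 := MemLp.integrable_sq hS
    have i2 : Integrable (fun ω => 2 * ((∑ m ∈ Finset.Icc 1 (M + 1), inner ℝ F (e m ω)) *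
        inner ℝ F (e (M + 1) ω))) P := (MemLp.integrable_mul hS' hz).const_mul 2
    have i12 := i1.add i2
    rw [e1, integral_sub (by exact i12) (MemLp.integrable_sq hz), integral_add i1 i2,
      integral_const_mul]
    have b1 := le_of_abs_le (h.abs_integral_sum_mul_le F (M + 1) F)
    rw [mul_assoc d, Real.mul_self_sqrt (quadForm_nonneg h.posSemidef _)] at b1
    have b2 : 0 ≤ ∫ ω, inner ℝ F (e (M + 1) ω) ^ 2 ∂P := integral_nonneg fun ω => sq_nonneg _
    push_cast
    linarith

end IsAutoregressive

end Autoregressive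

/-! ### Gaussian draws -/

section Gaussian

variable {Ω : Type*} [MeasurableSpace Ω] {P : Measure Ω} {k : ℕ} {Y : Ω → Vec k} {W : Mat k}

theorem coordMem_of_memLp (h : MemLp Y 2 P) : CoordMem (squareIntegrable P) Y :=
  fun p => h.const_inner p

theorem memLp_of_hasLaw_gaussian (h : HasLaw Y (multivariateGaussian 0 W) P) : MemLp Y 2 P := by
  have := IsGaussian.memLp_two_id (μ := multivariateGaussian 0 W)
  rw [← h.map_eq] at this
  exact (memLp_map_measure_iff aestronglyMeasurable_id h.aemeasurable).1 this

theorem integral_inner_of_hasLaw_gaussian (h : HasLaw Y (multivariateGaussian 0 W) P)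
    (p : Vec k) : ∫ ω, inner ℝ p (Y ω) ∂P = 0 := by
  have h1 : ∫ x, inner ℝ p x ∂(multivariateGaussian 0 W) = 0 := by
    rw [integral_inner IsGaussian.integrable_fun_id, integral_id_multivariateGaussian,
      inner_zero_right]
  rw [← h.map_eq, integral_map h.aemeasurable (by fun_prop)] at h1
  exact h1

theorem secondMoment_of_hasLaw_gaussian (hW : W.PosSemidef)
    (h : HasLaw Y (multivariateGaussian 0 W) P) : SecondMoment P Y W := fun p => by
  have h1 : ∫ x, inner ℝ p x ^ 2 ∂(multivariateGaussian 0 W) = quadForm W p.ofLp := by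
    have := covarianceBilin_multivariateGaussian (μ := 0) hW p p
    rw [covarianceBilin_apply IsGaussian.memLp_two_id, integral_id_multivariateGaussian'] at this
    simpa [quadForm, sq] using this
  rw [← h.map_eq, integral_map h.aemeasurable (by fun_prop)] at h1
  exact h1

end Gaussian

theorem exactValue_eq {k : ℕ} (A : Mat k) (f F : Vec k) :
    exactValue A f F = inner ℝ F (toEuclideanLin A⁻¹ f) := by
  rw [exactValue, integral_inner IsGaussian.integrable_fun_id, integral_id_multivariateGaussian]

theorem exactValue_sub_estimator {Ω : Type*} {k : ℕ} (A : Mat k) (f F : Vec k) {θ : ℕ → Ω → Vec k} {m : ℕ}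
    (hm : 1 ≤ m) (ω : Ω) : |exactValue A f F - estimator F θ m ω| ^ 2 =
      (1 / (m : ℝ)) ^ 2 *
        (∑ j ∈ Finset.Icc 1 m, inner ℝ F (θ j ω - toEuclideanLin A⁻¹ f)) ^ 2 := by
  have hm0 : (m : ℝ) ≠ 0 := by positivity
  rw [sq_abs, exactValue_eq, estimator, ← mul_pow]
  simp only [inner_sub_right, Finset.sum_sub_distrib, Finset.sum_const, Nat.card_Icc,
    Nat.add_sub_cancel, nsmul_eq_mul, mul_sub]
  rw [← mul_assoc, one_div_mul_cancel hm0]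
  ring

/-! ### The Multigrid Monte Carlo chain -/

section Chain

variable {n : ℕ → ℕ} {A M : ∀ ℓ, Mat (n ℓ)}
  {I : ∀ ℓ, Matrix (Fin (n (ℓ + 1))) (Fin (n ℓ)) ℝ} {c : ℝ} {μ L : ℕ} {f : Vec (n L)}
  {Ω : Type*} [MeasurableSpace Ω] {P : Measure Ω} {θ : ℕ → Ω → Vec (n L)}
  {ξ : ℕ → (i : Draw) → Ω → Vec (n i.level)}

theorem drawLaw_eq (A M : ∀ ℓ, Mat (n ℓ)) (i : Draw) :
    drawLaw A M M i = multivariateGaussian 0 (drawCov A M i) := by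
  cases i <;> rfl

theorem SmoothingProperty.posSemidef_noise {k : ℕ} {A M : Mat k} (h : SmoothingProperty A M) :
    (M + Mᵀ - A).PosSemidef := by
  rw [h.1, add_sub_assoc]
  exact h.posDef_right.posSemidef.add h.2.2

theorem IsMultigrid.posSemidef_drawCov (h : IsMultigrid A M I c) {i : Draw}
    (hi : i.Used L μ μ) : (drawCov A M i).PosSemidef := by
  cases i with
  | coarse => exact (h.posDef 0).inv.posSemidef
  | pre ℓ j =>
    -- Smoothing draws are used only on levels `ℓ ≥ 1`, where the smoothing property is available.
    obtain ⟨ℓ, rfl⟩ := Nat.exists_eq_succ_of_ne_zero (Nat.one_le_iff_ne_zero.1 hi.1)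
    exact (h.smoothing ℓ).posSemidef_noise
  | post ℓ j =>
    obtain ⟨ℓ, rfl⟩ := Nat.exists_eq_succ_of_ne_zero (Nat.one_le_iff_ne_zero.1 hi.1)
    exact (h.smoothing ℓ).posSemidef_noise

namespace IsMGMCChain

theorem hasLaw_gaussian (hch : IsMGMCChain A M M I μ μ L f P θ ξ) (m : ℕ) {i : Draw}
    (hi : i.Used L μ μ) : HasLaw (ξ m i) (multivariateGaussian 0 (drawCov A M i)) P :=
  drawLaw_eq A M i ▸ hch.law_draw m i hi

theorem orthogonal_draw (hch : IsMGMCChain A M M I μ μ L f P θ ξ) {m j : ℕ} {i i' : Draw}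
    (hi : i.Used L μ μ) (hi' : i'.Used L μ μ) (hne : m ≠ j ∨ i ≠ i') :
    Orthogonal P (ξ m i) (ξ j i') := fun p q => by
  have hne' : (m, (⟨i, hi⟩ : {i : Draw // i.Used L μ μ})) ≠ (j, ⟨i', hi'⟩) := by
    rintro ⟨⟩
    simp at hne
  have hind : IndepFun (ξ m i) (ξ j i') P := hch.indep_draw.indepFun hne'
  have hm := (hch.measurable_draw m i hi)
  have hm' := (hch.measurable_draw j i' hi')
  have := (hind.comp (φ := fun x => inner ℝ p x) (ψ := fun x => inner ℝ q x) (by fun_prop)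
    (by fun_prop)).integral_fun_mul_eq_mul_integral (by fun_prop) (by fun_prop)
  refine this.trans ?_
  have h0 : ∫ ω, ((fun x => inner ℝ p x) ∘ ξ m i) ω ∂P = 0 :=
    integral_inner_of_hasLaw_gaussian (hch.hasLaw_gaussian m hi) p
  rw [h0, zero_mul]

/-- Independence factors the expectation and the draw has mean zero, so the initial error may have
any mean. -/
theorem orthogonal_init (hch : IsMGMCChain A M M I μ μ L f P θ ξ) (m : ℕ) {i : Draw}
    (hi : i.Used L μ μ) (b : Vec (n L)) : Orthogonal P (ξ m i) (fun ω => θ 0 ω - b) :=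
  fun p q => by
    have hm := hch.measurable_draw m i hi
    have hm' := hch.measurable_init
    have hind : IndepFun (θ 0) (ξ m i) P := hch.indep_init.comp measurable_id
      (measurable_pi_apply (m, (⟨i, hi⟩ : {i : Draw // i.Used L μ μ})))
    have hind' := hind.comp (φ := fun x => inner ℝ q (x - b)) (ψ := fun x => inner ℝ p x)
      (by fun_prop) (by fun_prop)
    have := hind'.symm.integral_fun_mul_eq_mul_integral (by fun_prop) (by fun_prop)
    refine this.trans ?_
    have h0 : ∫ ω, ((fun x => inner ℝ p x) ∘ ξ m i) ω ∂P = 0 :=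
      integral_inner_of_hasLaw_gaussian (hch.hasLaw_gaussian m hi) p
    rw [h0, zero_mul]

theorem isDrawFamily (h : IsMultigrid A M I c) (hch : IsMGMCChain A M M I μ μ L f P θ ξ)
    (m : ℕ) : IsDrawFamily A M μ L P (ξ m) where
  coordMem _ hi := coordMem_of_memLp (memLp_of_hasLaw_gaussian (hch.hasLaw_gaussian m hi))
  secondMoment _ hi :=
    secondMoment_of_hasLaw_gaussian (h.posSemidef_drawCov hi) (hch.hasLaw_gaussian m hi)
  orthogonal _ _ hi hj hij := hch.orthogonal_draw hi hj (.inr hij)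

/-- The error of the Multigrid Monte Carlo chain is an autoregressive process. -/
theorem isAutoregressive [IsProbabilityMeasure P] (h : IsMultigrid A M I c) (hc : 0 < c)
    (hμ : 0 < μ) (hch : IsMGMCChain A M M I μ μ L f P θ ξ) (hθ : MemLp (θ 0) 2 P) {d : ℝ}
    (hd : 1 ≤ d) (hinit : ∀ p : Vec (n L),
      ∫ ω, inner ℝ p (θ 0 ω - toEuclideanLin (A L)⁻¹ f) ^ 2 ∂P ≤ d * quadForm (A L)⁻¹ p.ofLp) :
    IsAutoregressive P (vcycleMat A M I μ L) (A L)⁻¹ (c / (c + 2 * μ)) d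
      (fun m ω => θ m ω - toEuclideanLin (A L)⁻¹ f)
      (fun m ω => mgmc A M M I μ μ (fun i => ξ m i ω) L 0 0) where
  posSemidef := (h.posDef L).inv.posSemidef
  rate_nonneg := by positivity
  rate_lt_one := by
    have : (0 : ℝ) < μ := by exact_mod_cast hμ
    rw [div_lt_one (by positivity)]
    linarith
  contraction := h.quadForm_inv_transpose_vcycleMat_le hc hμ L
  step m ω := by
    beta_reduce
    rw [hch.step, mgmc_sub h]
  coordMem_init := coordMem_of_memLp (hθ.sub (memLp_const _))
  coordMem_noise m := (hch.isDrawFamily h m).coordMem_noise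
  orthogonal_init m := by
    have he := coordMem_of_memLp (hθ.sub (memLp_const (toEuclideanLin (A L)⁻¹ f)))
    refine Orthogonal.symm (Orthogonal.of_coordMem he fun p => ?_)
    exact CoordMem.mgmc L (fun i hi => (hch.orthogonal_init m hi _).symm.coordMem he
      ((hch.isDrawFamily h m).coordMem i hi) p) CoordMem.zero CoordMem.zero
  orthogonal_noise m j hmj := by
    have hm := hch.isDrawFamily h m
    have hj := hch.isDrawFamily h j
    refine Orthogonal.of_coordMem hm.coordMem_noise fun p => ?_
    refine CoordMem.mgmc L (fun i hi => ?_) CoordMem.zero CoordMem.zero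
    refine (Orthogonal.symm (Orthogonal.of_coordMem (hj.coordMem i hi) fun q => ?_)).coordMem
      hm.coordMem_noise (hj.coordMem i hi) p
    exact CoordMem.mgmc L (fun i' hi' => (hch.orthogonal_draw hi hi' (.inl hmj.symm)).coordMem _
      (hm.coordMem i' hi') q) CoordMem.zero CoordMem.zero
  secondMoment_noise m := (hch.isDrawFamily h m).secondMoment_noise h
  one_le := hd
  init_le := hinit

end IsMGMCChain

/-- The mean square error of the Multigrid Monte Carlo estimator. -/
theorem IsMGMCChain.mse_le [IsProbabilityMeasure P] (h : IsMultigrid A M I c) (hc : 0 < c)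
    (hμ : 0 < μ) (hch : IsMGMCChain A M M I μ μ L f P θ ξ) (hθ : MemLp (θ 0) 2 P) {d : ℝ}
    (hd : 1 ≤ d) (hinit : ∀ p : Vec (n L),
      ∫ ω, inner ℝ p (θ 0 ω - toEuclideanLin (A L)⁻¹ f) ^ 2 ∂P ≤ d * quadForm (A L)⁻¹ p.ofLp)
    (F : Vec (n L)) {m : ℕ} (hm : 1 ≤ m) :
    Integrable (fun ω => |exactValue (A L) f F - estimator F θ m ω| ^ 2) P ∧
      ∫ ω, |exactValue (A L) f F - estimator F θ m ω| ^ 2 ∂P ≤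
        2 * (d * quadForm (A L)⁻¹ F.ofLp / (1 - c / (c + 2 * μ))) / m := by
  have har := hch.isAutoregressive h hc hμ hθ hd hinit
  have hm0 : (0 : ℝ) < m := by positivity
  simp only [exactValue_sub_estimator _ _ _ hm]
  refine ⟨(MemLp.integrable_sq (CoordMem.sum_mem (fun j _ => har.coordMem j) F)).const_mul _, ?_⟩
  rw [integral_const_mul]
  refine (mul_le_mul_of_nonneg_left (har.integral_sum_sq_le F m) (by positivity)).trans_eq ?_
  field_simp

end Chain

/-! ### Matrix square roots -/

section Sqrt

variable {k : ℕ} {M : Mat k}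

open scoped MatrixOrder in
theorem msqrt_mul_self (h : M.PosSemidef) : msqrt M * msqrt M = M :=
  CFC.sqrt_mul_sqrt_self M h.nonneg

open scoped MatrixOrder in
theorem transpose_msqrt (M : Mat k) : (msqrt M)ᵀ = msqrt M :=
  isSymm_of_posSemidef (nonneg_iff_posSemidef.1 (CFC.sqrt_nonneg M))

/-- Substitution `p = M^{1/2} q`. -/
theorem exists_msqrt_mulVec (h : M.PosDef) (p : Vec k) :
    ∃ q : Vec k, p = toEuclideanLin (msqrt M) q ∧ ‖q‖ ^ 2 = quadForm M⁻¹ p.ofLp := by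
  have hs := msqrt_mul_self h.posSemidef
  have hu : IsUnit (msqrt M).det := by
    have := (isUnit_iff_isUnit_det _).1 h.isUnit
    rw [← hs, det_mul] at this
    exact isUnit_of_mul_isUnit_left this
  refine ⟨toEuclideanLin (msqrt M)⁻¹ p, ?_, ?_⟩
  · rw [← toEuclideanLin_mul_apply, mul_nonsing_inv _ hu, toEuclideanLin_one_apply]
  · rw [← real_inner_self_eq_norm_sq, inner_toEuclideanLin, ← toEuclideanLin_mul_apply,
      real_inner_comm, inner_toEuclideanLin_self, transpose_nonsing_inv, transpose_msqrt]
    congr 1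
    rw [← Matrix.mul_inv_rev, hs]

/-- Under `p = M^{1/2} q` the form of `W` becomes that of `M^{1/2} W M^{1/2}`, and `‖q‖² = M⁻¹[p]`.
This serves both the approximation property and, with `M = A`, the bound on the initial covariance.
-/
theorem quadForm_le_of_norm₂_le (h : M.PosDef) {W : Mat k} {c : ℝ}
    (hc : norm₂ (msqrt M * W * msqrt M) ≤ c) (p : Fin k → ℝ) :
    quadForm W p ≤ c * quadForm M⁻¹ p := by
  obtain ⟨q, hq, hn⟩ := exists_msqrt_mulVec h (WithLp.toLp 2 p)
  have e : quadForm W p = quadForm (msqrt M * W * msqrt M) q.ofLp := by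
    have hp : p = (msqrt M)ᵀ *ᵥ q.ofLp := by
      rw [transpose_msqrt]
      simpa using congrArg WithLp.ofLp hq
    have := quadForm_conj (msqrt M) W q.ofLp
    rw [← hp, transpose_msqrt] at this
    exact this.symm
  rw [e, quadForm, ← inner_toEuclideanCLM, ← hn]
  refine (real_inner_le_norm _ _).trans ?_
  have h1 := (toEuclideanCLM (n := Fin k) (𝕜 := ℝ) (msqrt M * W * msqrt M)).le_of_opNorm_le hc q
  nlinarith [norm_nonneg q]

end Sqrt

/-! ### The energy form -/

section Hierarchy

variable {H : Type*} [NormedAddCommGroup H] [InnerProductSpace ℝ H]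
  {T : H →L[ℝ] H}

/-- Evaluating `LinearPMap.inverse` as an inverse requires a trivial kernel, which positive
definiteness of `T` supplies. -/
theorem invSqrt_precisionSqrt [CompleteSpace H] (hT : IsCovarianceOperator T) (u : (precisionSqrt T).domain) :
    invSqrt T (precisionSqrt T u) = u := by
  have hker : ((invSqrt T : H →ₗ[ℝ] H).toPMap ⊤).toFun.ker = ⊥ := by
    rw [LinearMap.ker_eq_bot]
    intro x y hxy
    exact Subtype.ext (invSqrt_injective hT hxy)
  have hu : (u : H) ∈ LinearMap.range ((invSqrt T : H →ₗ[ℝ] H).toPMap ⊤).toFun := by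
    rw [← LinearPMap.inverse_domain]
    exact u.2
  obtain ⟨x, hx⟩ := hu
  have := LinearPMap.inverse_apply_eq hker (y := u) (x := x) hx
  exact (congrArg (invSqrt T) this).trans hx

theorem precisionSqrt_injective [CompleteSpace H] (hT : IsCovarianceOperator T)
    {u : (precisionSqrt T).domain} (hu : precisionSqrt T u = 0) : u = 0 := by
  have := invSqrt_precisionSqrt hT u
  rw [hu, map_zero] at this
  exact Subtype.ext this.symm

namespace Hierarchy

variable (𝓗 : Hierarchy T)

theorem dotProduct_A_mulVec (ℓ : ℕ) (x y : Fin (𝓗.n ℓ) → ℝ) :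
    x ⬝ᵥ 𝓗.A ℓ *ᵥ y = energyForm T (∑ j, x j • 𝓗.φ ℓ j) (∑ j, y j • 𝓗.φ ℓ j) := by
  have h : ∀ z : Fin (𝓗.n ℓ) → ℝ, precisionSqrt T (∑ j, z j • 𝓗.φ ℓ j) =
      ∑ j, z j • precisionSqrt T (𝓗.φ ℓ j) := fun z => by
    have := map_sum (precisionSqrt T).toFun (fun j => z j • 𝓗.φ ℓ j) Finset.univ
    simp only [map_smul] at this
    exact this
  simp only [energyForm, h, sum_inner, inner_sum, dotProduct, mulVec, A, Matrix.of_apply,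
    real_inner_smul_left, real_inner_smul_right, Finset.mul_sum]
  rw [Finset.sum_comm]
  refine Finset.sum_congr rfl fun i _ => Finset.sum_congr rfl fun j _ => ?_
  ring

theorem quadForm_A (ℓ : ℕ) (x : Fin (𝓗.n ℓ) → ℝ) :
    quadForm (𝓗.A ℓ) x = ‖precisionSqrt T (∑ j, x j • 𝓗.φ ℓ j)‖ ^ 2 := by
  rw [quadForm, dotProduct_A_mulVec, energyForm, real_inner_self_eq_norm_sq]

theorem posDef_A [CompleteSpace H] (hT : IsCovarianceOperator T) (ℓ : ℕ) : (𝓗.A ℓ).PosDef := by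
  refine PosDef.of_dotProduct_mulVec_pos ?_ fun {x} hx => ?_
  · ext i j
    exact real_inner_comm _ _
  · have h := 𝓗.quadForm_A ℓ x
    rw [quadForm] at h
    rw [star_trivial, h]
    have hne : precisionSqrt T (∑ j, x j • 𝓗.φ ℓ j) ≠ 0 := fun h0 => hx <| by
      have := Fintype.linearIndependent_iff.1 (𝓗.linearIndependent ℓ) x
        (precisionSqrt_injective hT h0)
      exact funext this
    positivity

theorem sum_prolongation (ℓ : ℕ) (k : Fin (𝓗.n ℓ)) :
    ∑ j, 𝓗.prolongation ℓ j k • 𝓗.φ (ℓ + 1) j = 𝓗.φ ℓ k := by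
  have h := (Module.Basis.span (𝓗.linearIndependent (ℓ + 1))).sum_repr
    ⟨𝓗.φ ℓ k, 𝓗.nested ℓ (Submodule.subset_span ⟨k, rfl⟩)⟩
  have := congrArg (Submodule.subtype _) h
  simp only [map_sum, map_smul, Module.Basis.span_apply] at this
  exact this

/-- The prolongation merely rewrites coarse basis functions in the fine basis, so both sides are the
same energy form evaluated on them. -/
theorem galerkin (ℓ : ℕ) :
    (𝓗.prolongation ℓ)ᵀ * 𝓗.A (ℓ + 1) * 𝓗.prolongation ℓ = 𝓗.A ℓ := by
  ext i k
  have := 𝓗.dotProduct_A_mulVec (ℓ + 1) (fun j => 𝓗.prolongation ℓ j i)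
    (fun j => 𝓗.prolongation ℓ j k)
  rw [sum_prolongation, sum_prolongation] at this
  rw [Matrix.mul_assoc]
  exact this

theorem isMultigrid [CompleteSpace H] (hT : IsCovarianceOperator T) {S : ∀ ℓ, Mat (𝓗.n ℓ)}
    (hsmooth : ∀ ℓ, 1 ≤ ℓ → SmoothingProperty (𝓗.A ℓ) (S ℓ)) {c : ℝ}
    (happrox : ApproximationProperty 𝓗 S c) : IsMultigrid 𝓗.A S 𝓗.prolongation c where
  posDef := 𝓗.posDef_A hT
  smoothing ℓ := hsmooth (ℓ + 1) ℓ.succ_pos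
  galerkin := 𝓗.galerkin
  approximation ℓ := quadForm_le_of_norm₂_le (hsmooth (ℓ + 1) ℓ.succ_pos).posDef_right (happrox ℓ)

/-- The energy norm of the solution operator on dual vectors is bounded uniformly in the level. -/
theorem quadForm_inv_dualVec_le [CompleteSpace H] (hT : IsCovarianceOperator T) (ℓ : ℕ) (g : H) :
    quadForm (𝓗.A ℓ)⁻¹ (𝓗.dualVec ℓ g).ofLp ≤ (‖g‖ * ‖invSqrt T‖) ^ 2 := by
  -- Here `x` holds the coefficients of the Galerkin solution `u` for `g`. The form equals both
  -- `‖𝒜^{1/2} u‖²` and `⟨g, u⟩`, and `‖u‖ ≤ ‖𝒜^{-1/2}‖ ‖𝒜^{1/2} u‖`; one factor `‖𝒜^{1/2} u‖`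
  -- cancels.
  have hA := 𝓗.posDef_A hT ℓ
  set x := (𝓗.A ℓ)⁻¹ *ᵥ (𝓗.dualVec ℓ g).ofLp with hx
  set u := ∑ j, x j • 𝓗.φ ℓ j with hu
  have h1 : quadForm (𝓗.A ℓ)⁻¹ (𝓗.dualVec ℓ g).ofLp = ‖precisionSqrt T u‖ ^ 2 := by
    rw [hu, ← quadForm_A, quadForm, quadForm, hx, mulVec_mulVec, mul_inv_of_posDef hA, one_mulVec,
      dotProduct_comm]
  have h2 : quadForm (𝓗.A ℓ)⁻¹ (𝓗.dualVec ℓ g).ofLp = inner ℝ g (u : H) := by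
    rw [quadForm, ← hx, hu]
    simp [dualVec, dotProduct, inner_sum, real_inner_smul_right, mul_comm]
  have h3 : ‖precisionSqrt T u‖ ^ 2 ≤ ‖g‖ * ‖invSqrt T‖ * ‖precisionSqrt T u‖ := by
    rw [← h1, h2, ← invSqrt_precisionSqrt hT u, mul_assoc]
    exact (real_inner_le_norm _ _).trans
      (mul_le_mul_of_nonneg_left ((invSqrt T).le_opNorm _) (norm_nonneg g))
  rw [h1]
  refine pow_le_pow_left₀ (norm_nonneg _) ?_ 2
  rcases (norm_nonneg (precisionSqrt T u)).eq_or_lt with h0 | h0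
  · rw [← h0]; positivity
  · exact le_of_mul_le_mul_right (by rwa [← sq]) h0

end Hierarchy

end Hierarchy

/-! ### The initial state -/

section Init

variable {Ω : Type*} [MeasurableSpace Ω] {P : Measure Ω} [IsProbabilityMeasure P] {k : ℕ}

theorem variance_inner_eq {Y : Ω → Vec k} (hY : MemLp Y 2 P) (p : Vec k) :
    variance (fun ω => inner ℝ p (Y ω)) P = quadForm (covMatrix P Y) p.ofLp := by
  have hYi : ∀ i, MemLp (fun ω => Y ω i) 2 P := fun i => by
    have := hY.const_inner (𝕜 := ℝ) (EuclideanSpace.single i (1 : ℝ))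
    simpa [EuclideanSpace.inner_single_left] using this
  have h := covarianceBilin_apply_pi hYi p p
  have e : (fun ω => WithLp.toLp 2 (fun i => Y ω i)) = Y := rfl
  rw [e] at h
  have hm : AEMeasurable Y P := hY.aestronglyMeasurable.aemeasurable
  rw [covarianceBilin_apply_eq_cov ((memLp_map_measure_iff aestronglyMeasurable_id hm).2 hY),
    covariance_map (by fun_prop) (by fun_prop) hm, covariance_self] at h
  · refine h.trans ?_
    simp only [quadForm, dotProduct, mulVec, covMatrix, Matrix.of_apply, Finset.mul_sum]
    refine Finset.sum_congr rfl fun i _ => Finset.sum_congr rfl fun j _ => ?_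
    ring
  · exact (by fun_prop : Measurable fun x : Vec k => inner ℝ p x).comp_aemeasurable hm

/-- The second moment of the initial error in terms of its mean and covariance. -/
theorem integral_inner_sub_sq_le {A : Mat k} (hA : A.PosDef) {f : Vec k} {Y : Ω → Vec k}
    (hY : MemLp Y 2 P) {C₀ C₁ B : ℝ}
    (hcov : norm₂ (msqrt A * covMatrix P Y * msqrt A) ≤ C₀)
    (hmean : ‖∫ ω, toEuclideanLin (msqrt A) (Y ω) ∂P‖ ≤ C₁)
    (hB : 0 ≤ B) (hf : quadForm A⁻¹ f.ofLp ≤ B ^ 2) (p : Vec k) :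
    ∫ ω, inner ℝ p (Y ω - toEuclideanLin A⁻¹ f) ^ 2 ∂P ≤
      (C₀ + (C₁ + B) ^ 2) * quadForm A⁻¹ p.ofLp := by
  set b := toEuclideanLin A⁻¹ f with hb
  have hp := hY.const_inner (𝕜 := ℝ) p
  have hpb : MemLp (fun ω => inner ℝ p (Y ω - b)) 2 P := (hY.sub (memLp_const b)).const_inner p
  have hv : variance (fun ω => inner ℝ p (Y ω - b)) P = quadForm (covMatrix P Y) p.ofLp := by
    rw [← variance_inner_eq hY]
    simp only [inner_sub_right]
    exact variance_sub_const hp.aestronglyMeasurable _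
  have hv' := variance_eq_sub hpb
  have hcov' := quadForm_le_of_norm₂_le hA hcov p.ofLp
  -- Writing `p = A^{1/2} q` turns the mean of `p · Y` into `q · 𝔼[A^{1/2} Y]`, which the assumption
  -- bounds. The covariance contributes `C₀`, the squared mean of the error `(C₁ + B) ^ 2`.
  obtain ⟨q, hq, hn⟩ := exists_msqrt_mulVec hA p
  have hYint : Integrable Y P := hY.integrable one_le_two
  have hsY : Integrable (fun ω => toEuclideanLin (msqrt A) (Y ω)) P :=
    (LinearMap.toContinuousLinearMap (toEuclideanLin (msqrt A))).integrable_comp hYint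
  have e1 : ∫ ω, inner ℝ p (Y ω) ∂P = inner ℝ q (∫ ω, toEuclideanLin (msqrt A) (Y ω) ∂P) := by
    rw [← integral_inner hsY]
    simp only [inner_toEuclideanLin (msqrt A), transpose_msqrt, ← hq]
  have e2 : ∫ ω, inner ℝ p (Y ω - b) ∂P = ∫ ω, inner ℝ p (Y ω) ∂P - inner ℝ p b := by
    simp only [inner_sub_right]
    rw [integral_sub (hp.integrable one_le_two) (integrable_const _)]
    simp
  have b1 : |∫ ω, inner ℝ p (Y ω) ∂P| ≤ ‖q‖ * C₁ := by
    rw [e1]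
    exact (abs_real_inner_le_norm _ _).trans (mul_le_mul_of_nonneg_left hmean (norm_nonneg q))
  have b2 : |inner ℝ p b| ≤ ‖q‖ * B := by
    refine abs_le_of_sq_le_sq ?_ (by positivity)
    have := sq_dotProduct_mulVec_le hA.inv.posSemidef p.ofLp f.ofLp
    have hpb : inner ℝ p b = p.ofLp ⬝ᵥ A⁻¹ *ᵥ f.ofLp := by
      rw [hb]
      simp [EuclideanSpace.inner_eq_star_dotProduct, dotProduct_comm]
    rw [hpb, mul_pow, hn]
    exact this.trans (mul_le_mul_of_nonneg_left hf (quadForm_nonneg hA.inv.posSemidef _))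
  have b3 : |∫ ω, inner ℝ p (Y ω - b) ∂P| ≤ ‖q‖ * (C₁ + B) := by
    rw [e2, mul_add]
    exact (abs_sub _ _).trans (add_le_add b1 b2)
  have b4 := pow_le_pow_left₀ (abs_nonneg _) b3 2
  rw [sq_abs, mul_pow, hn] at b4
  simp only [Pi.pow_apply] at hv'
  rw [hv] at hv'
  linarith

end Init

end MGMC

/-! ### The error bound uniform in the level -/

theorem mainTheorem5 {H : Type*} [NormedAddCommGroup H] [InnerProductSpace ℝ H]
    [CompleteSpace H] [TopologicalSpace.SeparableSpace H]
    -- the covariance operator `T = 𝒜⁻¹` and the discretisation spaces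
    (T : H →L[ℝ] H) (hT : MGMC.IsCovarianceOperator T) (𝓗 : MGMC.Hierarchy T)
    (hscale : 𝓗.BasisScaling)
    -- symmetric splitting matrices with the smoothing and the approximation property
    (S : ∀ ℓ, MGMC.Mat (𝓗.n ℓ)) (hsmooth : ∀ ℓ, 1 ≤ ℓ → MGMC.SmoothingProperty (𝓗.A ℓ) (S ℓ))
    (C_A : ℝ) (hC_A : 0 < C_A) (happrox : MGMC.ApproximationProperty 𝓗 S C_A)
    -- the number of smoothing steps
    (ν : ℕ) (hν : 0 < ν) (hν_even : Even ν)
    -- the right-hand side, the quantity of interest, and the bounds for the initial states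
    (f χ : H) (C₀ C₁ : ℝ) :
    ∃ C > 0, ∀ (L : ℕ) (Ω : Type*) [MeasurableSpace Ω] (ℙ : MeasureTheory.Measure Ω)
      [MeasureTheory.IsProbabilityMeasure ℙ]
      (θ : ℕ → Ω → MGMC.Vec (𝓗.n L)) (ξ : ℕ → (i : MGMC.Draw) → Ω → MGMC.Vec (𝓗.n i.level)),
      MGMC.IsMGMCChain 𝓗.A S S 𝓗.prolongation (ν / 2) (ν / 2) L (𝓗.dualVec L f) ℙ θ ξ →
      MeasureTheory.MemLp (θ 0) 2 ℙ →
      MGMC.norm₂ (MGMC.msqrt (𝓗.A L) * MGMC.covMatrix ℙ (θ 0) * MGMC.msqrt (𝓗.A L)) < C₀ →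
      ‖∫ ω, Matrix.toEuclideanLin (MGMC.msqrt (𝓗.A L)) (θ 0 ω) ∂ℙ‖ < C₁ →
      ∀ M : ℕ, 1 ≤ M →
        MeasureTheory.Integrable
          (fun ω => |MGMC.exactValue (𝓗.A L) (𝓗.dualVec L f) (𝓗.dualVec L χ) -
            MGMC.estimator (𝓗.dualVec L χ) θ M ω| ^ 2) ℙ ∧
        √(∫ ω, |MGMC.exactValue (𝓗.A L) (𝓗.dualVec L f) (𝓗.dualVec L χ) -
            MGMC.estimator (𝓗.dualVec L χ) θ M ω| ^ 2 ∂ℙ) ≤ C / √(M : ℝ) := by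
  set B := ‖f‖ * ‖MGMC.invSqrt T‖
  -- The maximum with `1` is what makes the bound `d A⁻¹` survive the steps of the chain, also for
  -- small `C₀`.
  set d := max 1 (C₀ + (C₁ + B) ^ 2)
  set ρ := C_A / (C_A + 2 * (ν / 2 : ℕ)) with hρ
  set D := 2 * (d * (‖χ‖ * ‖MGMC.invSqrt T‖) ^ 2 / (1 - ρ)) with hD
  have hμ : 0 < ν / 2 := by
    obtain ⟨r, rfl⟩ := hν_even
    omega
  have hρ1 : 0 < 1 - ρ := by
    have : (0 : ℝ) < (ν / 2 : ℕ) := by exact_mod_cast hμ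
    rw [hρ, sub_pos, div_lt_one (by positivity)]
    linarith
  have hd1 : 1 ≤ d := le_max_left _ _
  have hmg := 𝓗.isMultigrid hT hsmooth happrox
  -- `D` may vanish, for instance when `χ = 0`; the added `1` keeps the constant positive.
  refine ⟨√D + 1, by positivity, ?_⟩
  intro L Ω _ P _ θ ξ hch hθ hcov hmean M hM
  have hinit : ∀ p : MGMC.Vec (𝓗.n L), ∫ ω, inner ℝ p
      (θ 0 ω - Matrix.toEuclideanLin (𝓗.A L)⁻¹ (𝓗.dualVec L f)) ^ 2 ∂P ≤
      d * MGMC.quadForm (𝓗.A L)⁻¹ p.ofLp := fun p =>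
    (MGMC.integral_inner_sub_sq_le (𝓗.posDef_A hT L) hθ hcov.le hmean.le (by positivity)
      (𝓗.quadForm_inv_dualVec_le hT L f) p).trans (mul_le_mul_of_nonneg_right (le_max_right _ _)
        (MGMC.quadForm_nonneg (𝓗.posDef_A hT L).inv.posSemidef _))
  obtain ⟨hint, hle⟩ := hch.mse_le hmg hC_A hμ hθ hd1 hinit (𝓗.dualVec L χ) hM
  refine ⟨hint, ?_⟩
  have hle' : ∫ ω, |MGMC.exactValue (𝓗.A L) (𝓗.dualVec L f) (𝓗.dualVec L χ) -
      MGMC.estimator (𝓗.dualVec L χ) θ M ω| ^ 2 ∂P ≤ D / M := by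
    refine hle.trans ?_
    have := 𝓗.quadForm_inv_dualVec_le hT L χ
    rw [hD]
    gcongr
  refine (Real.sqrt_le_sqrt hle').trans ?_
  rw [Real.sqrt_div (by positivity)]
  gcongr
  linarith
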